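/- Fix an integer $k\ge 2$ and let $(T_{i,v})_{i\ge 1,\,v\ge 1}$ be i.i.d. exponential random variables with mean $1$. Let $G_{r,v}=\sum_{i=1}^{r}T_{i,v}$. Consider the path with nodes $1,\dots,n$ rooted at $1$. Node $v$ is called a one-record if $G_{1,v}<G_{k,u}$ for every $u$ with $1\le u<v$ (so node $1$ is always a one-record). Let $\mathcal X_{n,1}$ be the number of one-records among the nodes $1,\dots,n$. Then, as $n\to\infty$, $$ \mathbb E[\mathcal X_{n,1}(\mathcal X_{n,1}-1)]\sim \mathbb E[\mathcal X_{n,1}^2]\sim \gamma_k\, n^{2-\frac2k}, \qquad \gamma_k=\frac{\Gamma\left(\frac2k\right)(k!)^{\frac2k}}{k-1}+2\lambda_k, $$ where $$ \lambda_k=\frac{\pi\cot\left(\frac{\pi}{k}\right)\Gamma\left(\frac2k\right)(k!)^{\frac2k}}{2(k-2)(k-1)}\quad\text{for } k>2, \qquad \lambda_2=\frac{\pi^2}{4}. $$ Moreover, $$ \operatorname{Var}(\mathcal X_{n,1})\sim\left(\gamma_k-\eta_{k,1}^2\right)n^{2-\frac2k}, \qquad \eta_{k,1}=\frac{(k!)^{\frac1k}}{k-1}\,\Gamma\left(\frac1k\right),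 $$ and in particular, for $k=2$, $$ \operatorname{Var}(\mathcal X_{n,1})\sim\left(\frac{\pi^2}{2}+2-2\pi\right)n . $$ Here $a_n\sim b_n$ means $a_n/b_n\to1$. -/

import Mathlib

open MeasureTheory ProbabilityTheory

namespace KCut

noncomputable section

/-- `ringTime T r v ω` is the time `G_{r,v} = ∑_{i=1}^{r} T_{i,v}` at which the alarm clock of node
`v` rings for the `r`-th time. Holding times and nodes are numbered from `0`: `T i v` is the
`(i+1)`-st holding time of the `(v+1)`-st node of the path, counted from the root. -/
def ringTime {Ω : Type*} (T : ℕ → ℕ → Ω → ℝ) (r v : ℕ) (ω : Ω) : ℝ :=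
  ∑ i ∈ Finset.range r, T i v ω

/-- The event that node `v` of the path is an `r`-record: its clock rings for the `r`-th time
strictly before the clock of any ancestor `u < v` has rung `k` times.
The root (which has no ancestors) is always an `r`-record. -/
def recordEvent {Ω : Type*} (T : ℕ → ℕ → Ω → ℝ) (k r v : ℕ) : Set Ω :=
  {ω | ∀ u < v, ringTime T r v ω < ringTime T k u ω}

/-- The number `𝒳_{n,r}` of `r`-records in the path with `n` nodes. -/
def recordCount {Ω : Type*} (T : ℕ → ℕ → Ω → ℝ) (k n r : ℕ) (ω : Ω) : ℝ :=
  ∑ v ∈ Finset.range n, (recordEvent T k r v).indicator (fun _ => (1 : ℝ)) ω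

/-- The constant `η_{k,r} = (k!)^{r/k} / (k - r) * Γ(r/k) / Γ(r)`. -/
def eta (k r : ℕ) : ℝ :=
  (k.factorial : ℝ) ^ ((r : ℝ) / (k : ℝ)) / ((k : ℝ) - (r : ℝ)) *
    (Real.Gamma ((r : ℝ) / (k : ℝ)) / Real.Gamma (r : ℝ))

/-- The constant `λ_k`. -/
def lam (k : ℕ) : ℝ :=
  if k = 2 then Real.pi ^ 2 / 4
  else
    Real.pi * Real.cot (Real.pi / (k : ℝ)) * Real.Gamma (2 / (k : ℝ)) *
        (k.factorial : ℝ) ^ (2 / (k : ℝ)) /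
      (2 * ((k : ℝ) - 2) * ((k : ℝ) - 1))

/-- The constant `γ_k = Γ(2/k) (k!)^{2/k} / (k - 1) + 2 λ_k`. -/
def gam (k : ℕ) : ℝ :=
  Real.Gamma (2 / (k : ℝ)) * (k.factorial : ℝ) ^ (2 / (k : ℝ)) / ((k : ℝ) - 1) + 2 * lam k

end

end KCut

/-! Condition on first ring times. If node `v` (counted from `0`) first rings at `x`, it is a record
exactly when each of its `v` ancestors rings for the `k`-th time after `x`, which has probability
`tail k x ^ v`. For two nodes `u < v` with first rings `x`, `y`, the `u` ancestors of `u` must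
outlast `max x y`, the nodes strictly between must outlast `y`, and the remaining `k - 1` rings of
`u` must take longer than `y - x`. Summing over nodes expresses the first moment and the second
factorial moment as integrals of geometric sums and of `pairSum`.

Near zero `1 - tail k x` behaves like `x ^ k / k!`, so the relevant scale is `x = s / n ^ (1 / k)`.
There `n⁻¹ ∑ p ^ v` tends to `expMean`, `n⁻² pairSum` tends to `expPairMean`, and the factor `tail
(k - 1) (y - x)` tends to `1`. Dominated convergence applies because each rescaled geometric sum is
at most `scaleBound`, a multiple of `1 / (1 + s ^ 2)`, and `pairSum` is at most a product of two
such sums.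

The limits are evaluated by Tonelli. Homogeneity lets the radial variable be integrated first,
giving `Γ(1/k)` or `Γ(2/k)`. For pairs, the ratio `w` of the two times remains: `w ≥ 1` contributes
`1`, and `w < 1` contributes `squareConst`, found from a geometric series together with Euler's
expansion of the cotangent, or with the sum of inverse odd squares when `k = 2`.

The second moment differs from the factorial one by the mean, which is of lower order. Finally, an
asymptotic equivalence needs a nonzero constant, and `eta_sq_lt_gam` supplies it: sharing ancestors
makes the limiting pair density strictly larger, once symmetrised, than the product of the two
single densities. -/

namespace KCut

open Set Filter Topology
open scoped ENNReal Pointwise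

/-! ### Ring time laws and their tails near zero. -/

/-- The law of a sum of `r` independent standard exponential variables. -/
noncomputable def ringLaw : ℕ → Measure ℝ
  | 0 => Measure.dirac 0
  | r + 1 => (expMeasure 1) ∗ (ringLaw r)

instance isProbabilityMeasure_expMeasure_one : IsProbabilityMeasure (expMeasure 1) :=
  isProbabilityMeasure_expMeasure one_pos

instance isProbabilityMeasure_ringLaw (r : ℕ) : IsProbabilityMeasure (ringLaw r) := by
  induction r with
  | zero => unfold ringLaw; infer_instance
  | succ r ih => unfold ringLaw; infer_instance

lemma expMeasure_one_eq_withDensity :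
    expMeasure 1 = (volume.restrict (Ioi (0 : ℝ))).withDensity
      (fun x => ENNReal.ofReal (Real.exp (-x))) := by
  have h1 : expMeasure 1 = volume.withDensity (exponentialPDF 1) := rfl
  rw [h1, restrict_Ioi_eq_restrict_Ici, ← withDensity_indicator measurableSet_Ici]
  congr 1
  ext x
  rw [exponentialPDF_eq]
  by_cases hx : 0 ≤ x
  · simp [hx]
  · rw [indicator_of_notMem (by simpa using hx)]
    simp [hx]

lemma lintegral_expMeasure_one {f : ℝ → ℝ≥0∞} (hf : Measurable f) :
    ∫⁻ x, f x ∂(expMeasure 1) = ∫⁻ x in Ioi 0, ENNReal.ofReal (Real.exp (-x)) * f x := by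
  rw [expMeasure_one_eq_withDensity, lintegral_withDensity_eq_lintegral_mul _ (by fun_prop) hf]
  rfl

lemma measurable_measure_Iic_sub (μ : Measure ℝ) (x : ℝ) :
    Measurable fun t => μ (Iic (x - t)) :=
  Antitone.measurable fun _ _ h => measure_mono (Iic_subset_Iic.2 (by linarith))

lemma ringLaw_succ_Iic (r : ℕ) (x : ℝ) :
    ringLaw (r + 1) (Iic x) =
      ∫⁻ t in Ioi 0, ENNReal.ofReal (Real.exp (-t)) * ringLaw r (Iic (x - t)) := by
  rw [ringLaw, ← lintegral_indicator_one measurableSet_Iic,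
    Measure.lintegral_conv (measurable_one.indicator measurableSet_Iic),
    ← lintegral_expMeasure_one (measurable_measure_Iic_sub _ _)]
  refine lintegral_congr fun t => ?_
  rw [← lintegral_indicator_one measurableSet_Iic]
  refine lintegral_congr fun y => ?_
  simp only [indicator, mem_Iic, le_sub_iff_add_le', Pi.one_apply]

lemma ringLaw_Iic_of_neg (r : ℕ) {x : ℝ} (hx : x < 0) : ringLaw r (Iic x) = 0 := by
  induction r generalizing x with
  | zero => simp [ringLaw, hx]
  | succ r ih =>
    rw [ringLaw_succ_Iic]
    refine (setLIntegral_congr_fun measurableSet_Ioi (g := fun _ => 0) fun t ht => ?_).trans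
      (by simp)
    simp only [mem_Ioi] at ht
    simp only
    rw [ih (by linarith), mul_zero]

/-- Common induction step of the two bounds below: `c = 1` serves the upper one and `c = exp (-x)`
the lower one. -/
lemma setLIntegral_Ioc_pow_div_factorial (c : ℝ) (hc : 0 ≤ c) (r : ℕ) {x : ℝ} (hx : 0 ≤ x) :
    ∫⁻ t in Ioc 0 x, ENNReal.ofReal (c * ((x - t) ^ r / r.factorial)) =
      ENNReal.ofReal (c * (x ^ (r + 1) / (r + 1).factorial)) := by
  rw [← ofReal_integral_eq_lintegral_ofReal]
  · rw [← intervalIntegral.integral_of_le hx, intervalIntegral.integral_const_mul,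
      intervalIntegral.integral_div,
      intervalIntegral.integral_comp_sub_left (fun t => t ^ r) x, integral_pow]
    congr 2
    simp only [sub_self, sub_zero, Nat.factorial_succ]
    push_cast
    field_simp
    simp
  · exact (Continuous.integrableOn_Icc (by fun_prop)).mono_set Ioc_subset_Icc_self
  · refine (ae_restrict_iff' measurableSet_Ioc).2 (ae_of_all _ fun t ht => ?_)
    have : 0 ≤ x - t := by linarith [ht.2]
    positivity

/-- The joint density of the `r` exponentials is at most `1`, and the simplex of total at most `x`
has volume `x ^ r / r!`. -/
lemma ringLaw_Iic_le (r : ℕ) {x : ℝ} (hx : 0 ≤ x) :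
    ringLaw r (Iic x) ≤ ENNReal.ofReal (x ^ r / r.factorial) := by
  induction r generalizing x with
  | zero => simp [ringLaw, hx]
  | succ r ih =>
    rw [ringLaw_succ_Iic, ← one_mul (x ^ (r + 1) / _),
      ← setLIntegral_Ioc_pow_div_factorial 1 zero_le_one r hx,
      ← lintegral_indicator measurableSet_Ioi, ← lintegral_indicator measurableSet_Ioc]
    refine lintegral_mono fun t => ?_
    by_cases ht : 0 < t
    · rw [indicator_of_mem (mem_Ioi.2 ht)]
      by_cases htx : t ≤ x
      · rw [indicator_of_mem (mem_Ioc.2 ⟨ht, htx⟩), one_mul]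
        calc _ ≤ 1 * ENNReal.ofReal ((x - t) ^ r / r.factorial) := by
              gcongr
              · exact ENNReal.ofReal_le_one.2 (Real.exp_le_one_iff.2 (by linarith))
              · exact ih (by linarith)
          _ = _ := one_mul _
      · rw [ringLaw_Iic_of_neg _ (by linarith)]
        simp
    · rw [indicator_of_notMem (by simpa using ht)]
      exact zero_le

/-- On the simplex of total at most `x` the joint density is at least `exp (-x)`; in the induction,
`exp (-t)` and `exp (-(x - t))` multiply to this constant. -/
lemma le_ringLaw_Iic (r : ℕ) {x : ℝ} (hx : 0 ≤ x) :
    ENNReal.ofReal (Real.exp (-x) * (x ^ r / r.factorial)) ≤ ringLaw r (Iic x) := by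
  induction r generalizing x with
  | zero => simp [ringLaw, hx]
  | succ r ih =>
    rw [ringLaw_succ_Iic,
      ← setLIntegral_Ioc_pow_div_factorial _ (Real.exp_pos _).le r hx]
    refine (setLIntegral_mono' measurableSet_Ioc fun t ht => ?_).trans
      (lintegral_mono_set Ioc_subset_Ioi_self)
    calc _ = ENNReal.ofReal (Real.exp (-t) *
          (Real.exp (-(x - t)) * ((x - t) ^ r / r.factorial))) := by
          rw [← mul_assoc, ← Real.exp_add]; ring_nf
      _ = ENNReal.ofReal (Real.exp (-t)) *
          ENNReal.ofReal (Real.exp (-(x - t)) * ((x - t) ^ r / r.factorial)) :=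
          ENNReal.ofReal_mul (Real.exp_pos _).le
      _ ≤ _ := by
          gcongr
          exact ih (by linarith [ht.2])

/-- The probability that a sum of `r` independent standard exponential variables exceeds `x`. -/
noncomputable def tail (r : ℕ) (x : ℝ) : ℝ := (ringLaw r).real (Ioi x)

lemma tail_nonneg (r : ℕ) (x : ℝ) : 0 ≤ tail r x := measureReal_nonneg

lemma tail_le_one (r : ℕ) (x : ℝ) : tail r x ≤ 1 := measureReal_le_one

lemma ofReal_tail (r : ℕ) (x : ℝ) : ENNReal.ofReal (tail r x) = ringLaw r (Ioi x) :=
  ofReal_measureReal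

lemma antitone_tail (r : ℕ) : Antitone (tail r) := fun _ _ h =>
  measureReal_mono (Ioi_subset_Ioi h)

@[fun_prop]
lemma measurable_tail (r : ℕ) : Measurable (tail r) := (antitone_tail r).measurable

lemma one_sub_tail (r : ℕ) (x : ℝ) : 1 - tail r x = (ringLaw r).real (Iic x) := by
  rw [tail, ← compl_Iic, probReal_compl_eq_one_sub measurableSet_Iic]
  ring

lemma one_sub_tail_le (r : ℕ) {x : ℝ} (hx : 0 ≤ x) : 1 - tail r x ≤ x ^ r / r.factorial := by
  rw [one_sub_tail]
  exact ENNReal.toReal_le_of_le_ofReal (by positivity) (ringLaw_Iic_le r hx)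

lemma le_one_sub_tail (r : ℕ) {x : ℝ} (hx : 0 ≤ x) :
    Real.exp (-x) * (x ^ r / r.factorial) ≤ 1 - tail r x := by
  rw [one_sub_tail]
  exact (ENNReal.ofReal_le_iff_le_toReal (measure_ne_top _ _)).1 (le_ringLaw_Iic r hx)

/-! ### Independence and record probabilities. -/

section Probability

variable {Ω : Type*} [MeasurableSpace Ω] {P : Measure Ω} [IsProbabilityMeasure P]

/-- Grouping an independent family indexed by pairs into its rows. -/
lemma iIndepFun_rows {X : ℕ → ℕ → Ω → ℝ} (hX : ∀ v i, Measurable (X v i))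
    (h : iIndepFun (fun p : ℕ × ℕ => X p.1 p.2) P) :
    iIndepFun (fun v ω i => X v i ω) P := by
  have hs : iIndepFun (fun p : (_ : ℕ) × ℕ => X p.1 p.2) P :=
    h.precomp (Equiv.sigmaEquivProd ℕ ℕ).injective
  have hrow : ∀ v, iIndepFun (X v) P := fun v =>
    h.precomp (g := fun i => (v, i)) (fun a b hab => by simpa using hab)
  have : ∀ v i, IsProbabilityMeasure (P.map (X v i)) :=
    fun v i => Measure.isProbabilityMeasure_map (hX v i).aemeasurable
  -- Independence means that the joint law is a product measure. Currying turns the product over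
  -- pairs into the product over rows of the row products.
  have hc : (MeasurableEquiv.piCurry (fun _ _ : ℕ => ℝ)) ∘
      (fun ω (p : (_ : ℕ) × ℕ) => X p.1 p.2 ω) = fun ω v i => X v i ω := by
    ext; simp [Sigma.curry]
  rw [iIndepFun_iff_map_fun_eq_infinitePi_map (by fun_prop), ← hc,
    ← Measure.map_map (by fun_prop) (by fun_prop),
    (iIndepFun_iff_map_fun_eq_infinitePi_map (by fun_prop)).1 hs,
    Measure.infinitePi_map_piCurry (fun v i => P.map (X v i))]
  congr 1
  ext1 v
  rw [(iIndepFun_iff_map_fun_eq_infinitePi_map (by fun_prop)).1 (hrow v)]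

/-- Disintegration of the joint law of two independent variables. -/
lemma measure_pair_mem {α β : Type*} [MeasurableSpace α] [MeasurableSpace β] {Y : Ω → α} {B : Ω → β}
    (hY : Measurable Y) (hB : Measurable B) (h : IndepFun Y B P) {D : Set (α × β)}
    (hD : MeasurableSet D) :
    P {ω | (Y ω, B ω) ∈ D} = ∫⁻ y, P {ω | (y, B ω) ∈ D} ∂(P.map Y) := by
  have : IsProbabilityMeasure (P.map B) := Measure.isProbabilityMeasure_map hB.aemeasurable
  have h1 : P {ω | (Y ω, B ω) ∈ D} = P.map (fun ω => (Y ω, B ω)) D := by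
    rw [Measure.map_apply (by fun_prop) hD]; rfl
  rw [h1, h.map_prod_eq_prod_map_map hY.aemeasurable hB.aemeasurable, Measure.prod_apply hD]
  refine lintegral_congr fun y => ?_
  rw [Measure.map_apply hB (hD.preimage (by fun_prop))]
  rfl

lemma map_sum_range_eq_ringLaw {Y : ℕ → Ω → ℝ} (hY : ∀ i, Measurable (Y i))
    (hlaw : ∀ i, P.map (Y i) = expMeasure 1) (hind : iIndepFun Y P) (r : ℕ) :
    P.map (∑ i ∈ Finset.range r, Y i) = ringLaw r := by
  induction r with
  | zero =>
    simp only [Finset.range_zero, Finset.sum_empty, ringLaw]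
    exact (Measure.map_const P (0 : ℝ)).trans (by simp)
  | succ r ih =>
    have hm : Measurable (∑ i ∈ Finset.range r, Y i) := by
      simpa [Finset.sum_fn] using Finset.measurable_sum (Finset.range r) fun i _ => hY i
    rw [Finset.sum_range_succ, IndepFun.map_add_eq_map_conv_map hm (hY r)
      (hind.indepFun_sum_range_succ hY r),
      ih, hlaw, Measure.conv_comm, ringLaw]

variable {T : ℕ → ℕ → Ω → ℝ}

/-- The time between the first and the `(k+1)`-st ring of node `v`. -/
noncomputable def restTime (T : ℕ → ℕ → Ω → ℝ) (k v : ℕ) (ω : Ω) : ℝ :=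
  ∑ i ∈ Finset.range k, T (i + 1) v ω

omit [MeasurableSpace Ω] in
lemma ringTime_succ (T : ℕ → ℕ → Ω → ℝ) (k v : ℕ) (ω : Ω) :
    ringTime T (k + 1) v ω = T 0 v ω + restTime T k v ω := by
  rw [ringTime, restTime, Finset.sum_range_succ', add_comm]

omit [MeasurableSpace Ω] in
lemma ringTime_one (T : ℕ → ℕ → Ω → ℝ) (v : ℕ) (ω : Ω) : ringTime T 1 v ω = T 0 v ω := by
  simp [ringTime]

lemma measurable_ringTime (hT : ∀ i v, Measurable (T i v)) (k v : ℕ) :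
    Measurable (ringTime T k v) := by
  unfold ringTime; fun_prop

lemma measurable_restTime (hT : ∀ i v, Measurable (T i v)) (k v : ℕ) :
    Measurable (restTime T k v) := by
  unfold restTime; fun_prop

lemma measurableSet_recordEvent (hT : ∀ i v, Measurable (T i v)) (k r v : ℕ) :
    MeasurableSet (recordEvent T k r v) := by
  have : recordEvent T k r v = ⋂ u, ⋂ (_ : u < v), {ω | ringTime T r v ω < ringTime T k u ω} := by
    ext; simp [recordEvent]
  rw [this]
  exact .iInter fun u => .iInter fun _ =>
    measurableSet_lt (measurable_ringTime hT _ _) (measurable_ringTime hT _ _)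

variable (hT : ∀ i v, Measurable (T i v)) (hlaw : ∀ i v, P.map (T i v) = expMeasure 1)
  (hind : iIndepFun (fun p : ℕ × ℕ => T p.1 p.2) P)

include hT hlaw hind

lemma map_ringTime (k v : ℕ) : P.map (ringTime T k v) = ringLaw k := by
  rw [← map_sum_range_eq_ringLaw (fun i => hT i v) (fun i => hlaw i v)
    (hind.precomp (g := fun i => (i, v)) (fun a b hab => by simpa using hab))]
  congr 1
  ext ω
  simp [ringTime]

lemma map_restTime (k v : ℕ) : P.map (restTime T k v) = ringLaw k := by
  rw [← map_sum_range_eq_ringLaw (fun i => hT (i + 1) v) (fun i => hlaw (i + 1) v)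
    (hind.precomp (g := fun i => (i + 1, v)) (fun a b hab => by simpa using hab))]
  congr 1
  ext ω
  simp [restTime]

lemma measure_lt_ringTime (k v : ℕ) (x : ℝ) :
    P {ω | x < ringTime T k v ω} = ENNReal.ofReal (tail k x) := by
  rw [ofReal_tail, ← map_ringTime hT hlaw hind k v,
    Measure.map_apply (measurable_ringTime hT k v) measurableSet_Ioi]
  rfl

omit hlaw [IsProbabilityMeasure P] in
lemma indepFun_ring_rest (k v : ℕ) : IndepFun (T 0 v) (restTime T k v) P := by
  have h := (hind.precomp (g := fun i => (i, v)) (fun a b hab => by simpa using hab))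
  have h2 := (h.indepFun_finsetSum_of_notMem (fun i => hT i v)
    (s := (Finset.range k).map ⟨_, Nat.succ_injective⟩) (i := 0) (by simp)).symm
  convert! h2 using 1
  ext ω
  simp [restTime]

omit hlaw in
/-- The pairs formed by the first ring time and the remaining time are independent. -/
lemma iIndepFun_ring_rest (k : ℕ) :
    iIndepFun (fun v ω => (T 0 v ω, restTime T k v ω)) P := by
  have h : iIndepFun (fun v ω i => T i v ω) P :=
    -- The rows must be the nodes, whereas `T` takes the holding time index first; hence the swap.
    iIndepFun_rows (fun v i => hT i v) (hind.precomp (g := Prod.swap) Prod.swap_injective)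
  exact h.comp (fun _ f => (f 0, ∑ i ∈ Finset.range k, f (i + 1))) (fun _ => by fun_prop)

/-- The thresholds depend on the node because a pair of records imposes different ones above and
below the upper node. -/
lemma measure_forall_lt_ringTime (k : ℕ) (W : Finset ℕ) (c : ℕ → ℝ) :
    P {ω | ∀ w ∈ W, c w < ringTime T (k + 1) w ω} =
      ∏ w ∈ W, ENNReal.ofReal (tail (k + 1) (c w)) := by
  have h := (iIndepFun_ring_rest hT hind k).measure_inter_preimage_eq_mul W
    (sets := fun w => {z : ℝ × ℝ | c w < z.1 + z.2})
    (fun w _ => measurableSet_lt (by fun_prop) (by fun_prop))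
  rw [Finset.prod_congr rfl fun w _ => (measure_lt_ringTime hT hlaw hind (k + 1) w (c w)).symm]
  simp_rw [ringTime_succ]
  convert h using 2
  · ext ω
    simp
  · rfl

lemma map_ring_rest_ring (k : ℕ) {u v : ℕ} (huv : u ≠ v) :
    P.map (fun ω => ((T 0 u ω, restTime T k u ω), T 0 v ω)) =
      ((expMeasure 1).prod (ringLaw k)).prod (expMeasure 1) := by
  have hr := measurable_restTime hT k
  have h1 := (iIndepFun_ring_rest hT hind k).indepFun huv
  have h2 : IndepFun (fun ω => (T 0 u ω, restTime T k u ω)) (T 0 v) P :=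
    h1.comp measurable_id measurable_fst
  rw [h2.map_prod_eq_prod_map_map (by fun_prop) (by fun_prop),
    (indepFun_ring_rest hT hind k u).map_prod_eq_prod_map_map (by fun_prop) (by fun_prop),
    hlaw, hlaw, map_restTime hT hlaw hind]

/-- The probability that two given nodes are both one-records. -/
lemma measure_recordEvent_inter (k : ℕ) {u v : ℕ} (huv : u < v) :
    P (recordEvent T (k + 1) 1 u ∩ recordEvent T (k + 1) 1 v) =
      ∫⁻ z, ENNReal.ofReal (tail k (z.2 - z.1) *
        (tail (k + 1) (max z.1 z.2) ^ u * tail (k + 1) z.2 ^ (v - 1 - u)))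
        ∂((expMeasure 1).prod (expMeasure 1)) := by
  have hr := measurable_restTime hT k
  set W : Finset ℕ := (Finset.range v).erase u with hW
  have hY : Measurable (fun ω => ((T 0 u ω, restTime T k u ω), T 0 v ω)) := by fun_prop
  have hB : Measurable (fun ω (w : W) => ringTime T (k + 1) w ω) :=
    measurable_pi_lambda _ fun w => measurable_ringTime hT _ _
  have hYB : IndepFun (fun ω => ((T 0 u ω, restTime T k u ω), T 0 v ω))
      (fun ω (w : W) => ringTime T (k + 1) w ω) P := by
    have h := (iIndepFun_ring_rest hT hind k).indepFun_finset {u, v} W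
      (by rw [Finset.disjoint_left]; simp [hW]) (fun i => by fun_prop)
    have hφ : Measurable fun f : (({u, v} : Finset ℕ) → ℝ × ℝ) =>
        (f ⟨u, by simp⟩, (f ⟨v, by simp⟩).1) := by fun_prop
    have hψ : Measurable fun (f : W → ℝ × ℝ) (w : W) => (f w).1 + (f w).2 := by fun_prop
    have h' := h.comp hφ hψ
    convert! h' using 1
    ext ω w
    simp [ringTime_succ]
  -- Here `y` collects the first ring of `u`, its remaining time and the first ring of `v`.
  -- Ancestors of `u` must outlast both first rings, nodes after `u` only that of `v`. Node `u` is
  -- left out of `W` since its own clock is part of `y`.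
  set c : (ℝ × ℝ) × ℝ → ℕ → ℝ := fun y w => if w < u then max y.1.1 y.2 else y.2 with hc
  set D : Set (((ℝ × ℝ) × ℝ) × (W → ℝ)) :=
    {q | q.1.2 < q.1.1.1 + q.1.1.2 ∧ ∀ w : W, c q.1 w < q.2 w} with hD
  have hDm : MeasurableSet D := by
    have h1 : MeasurableSet {q : ((ℝ × ℝ) × ℝ) × (W → ℝ) | q.1.2 < q.1.1.1 + q.1.1.2} :=
      measurableSet_lt (by fun_prop) (by fun_prop)
    refine h1.inter ?_
    have : {q : ((ℝ × ℝ) × ℝ) × (W → ℝ) | ∀ w : W, c q.1 w < q.2 w} =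
        ⋂ w : W, {q | c q.1 w < q.2 w} := by ext; simp
    change MeasurableSet {q : ((ℝ × ℝ) × ℝ) × (W → ℝ) | ∀ w : W, c q.1 w < q.2 w}
    rw [this]
    refine .iInter fun w => measurableSet_lt ?_ (by fun_prop)
    simp only [hc]
    split_ifs <;> fun_prop
  have hset : recordEvent T (k + 1) 1 u ∩ recordEvent T (k + 1) 1 v =
      {ω | (((T 0 u ω, restTime T k u ω), T 0 v ω),
        fun w : W => ringTime T (k + 1) w ω) ∈ D} := by
    ext ω
    simp only [recordEvent, mem_inter_iff, mem_ofPred_eq, ringTime_one, hD, hc]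
    constructor
    · rintro ⟨h1, h2⟩
      refine ⟨by simpa [ringTime_succ] using h2 u huv, ?_⟩
      rintro ⟨w, hw⟩
      rw [Finset.mem_erase, Finset.mem_range] at hw
      simp only
      split_ifs with hwu
      · exact max_lt (h1 w hwu) (h2 w hw.2)
      · exact h2 w hw.2
    · rintro ⟨h1, h2⟩
      have h3 : ∀ w < v, w ≠ u → (if w < u then max (T 0 u ω) (T 0 v ω) else T 0 v ω) <
          ringTime T (k + 1) w ω := fun w hw hne =>
        h2 ⟨w, by rw [Finset.mem_erase, Finset.mem_range]; exact ⟨hne, hw⟩⟩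
      refine ⟨fun w hw => ?_, fun w hw => ?_⟩
      · have := h3 w (hw.trans huv) hw.ne
        rw [if_pos hw] at this
        exact (le_max_left _ _).trans_lt this
      · rcases eq_or_ne w u with rfl | hne
        · rw [ringTime_succ]; exact h1
        · refine lt_of_le_of_lt ?_ (h3 w hw hne)
          split_ifs
          · exact le_max_right _ _
          · exact le_rfl
  have hprob : ∀ y : (ℝ × ℝ) × ℝ, P {ω | (y, fun w : W => ringTime T (k + 1) w ω) ∈ D} =
      (Ioi (y.2 - y.1.1)).indicator (fun _ => ENNReal.ofReal
        (tail (k + 1) (max y.1.1 y.2) ^ u * tail (k + 1) y.2 ^ (v - 1 - u))) y.1.2 := by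
    intro y
    by_cases hy : y.2 < y.1.1 + y.1.2
    · have h1 : {ω | (y, fun w : W => ringTime T (k + 1) w ω) ∈ D} =
          {ω | ∀ w ∈ W, c y w < ringTime T (k + 1) w ω} := by
        ext ω; simp [hD, hy]
      rw [h1, measure_forall_lt_ringTime hT hlaw hind, indicator_of_mem (by
        simp only [mem_Ioi]; linarith), ← ENNReal.ofReal_prod_of_nonneg fun _ _ => tail_nonneg _ _]
      congr 1
      have hsplit : W = Finset.range u ∪ Finset.Ico (u + 1) v := by
        ext w; simp [hW]; omega
      rw [hsplit, Finset.prod_union (by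
        rw [Finset.disjoint_left]; intro w; simp; omega)]
      congr 1
      · rw [Finset.prod_congr rfl (g := fun _ => tail (k + 1) (max y.1.1 y.2))
          (fun w hw => by simp [hc, Finset.mem_range.1 hw])]
        simp
      · rw [Finset.prod_congr rfl (g := fun _ => tail (k + 1) y.2)
          (fun w hw => by
            rw [Finset.mem_Ico] at hw
            simp only [hc]
            rw [if_neg (by omega)])]
        simp
        congr 1
        omega
    · rw [indicator_of_notMem (by simp only [mem_Ioi]; linarith)]
      simp [hD, hy]
  rw [hset, measure_pair_mem hY hB hYB hDm, map_ring_rest_ring hT hlaw hind k huv.ne]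
  simp_rw [hprob]
  have hm : Measurable fun z : ℝ × ℝ => ENNReal.ofReal
      (tail (k + 1) (max z.1 z.2) ^ u * tail (k + 1) z.2 ^ (v - 1 - u)) := by fun_prop
  have hm' : Measurable fun y : (ℝ × ℝ) × ℝ => (Ioi (y.2 - y.1.1)).indicator
      (fun _ => ENNReal.ofReal
        (tail (k + 1) (max y.1.1 y.2) ^ u * tail (k + 1) y.2 ^ (v - 1 - u))) y.1.2 := by
    simp only [indicator, mem_Ioi]
    exact Measurable.ite (measurableSet_lt (by fun_prop) (by fun_prop)) (by fun_prop) (by fun_prop)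
  rw [lintegral_prod _ hm'.aemeasurable, lintegral_prod _ hm'.lintegral_prod_right'.aemeasurable,
    lintegral_prod _ (by fun_prop)]
  refine lintegral_congr fun x => ?_
  simp only
  have hx : Measurable fun q : ℝ × ℝ => ((x, q.1), q.2) := by fun_prop
  -- With the remaining time of `u` innermost, its indicator integrates to `tail k (y - x)`.
  rw [lintegral_lintegral_swap (by exact (hm'.comp hx).aemeasurable)]
  refine lintegral_congr fun y => ?_
  rw [lintegral_indicator_const measurableSet_Ioi, mul_comm,
    ENNReal.ofReal_mul (tail_nonneg _ _), ofReal_tail]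

/-- The probability that a given node is a one-record. -/
lemma measure_recordEvent (k v : ℕ) :
    P (recordEvent T (k + 1) 1 v) =
      ∫⁻ x, ENNReal.ofReal (tail (k + 1) x ^ v) ∂(expMeasure 1) := by
  have hr := measurable_restTime hT k
  set W : Finset ℕ := Finset.range v with hW
  have hB : Measurable (fun ω (w : W) => ringTime T (k + 1) w ω) :=
    measurable_pi_lambda _ fun w => measurable_ringTime hT _ _
  have hYB : IndepFun (T 0 v) (fun ω (w : W) => ringTime T (k + 1) w ω) P := by
    have h := (iIndepFun_ring_rest hT hind k).indepFun_finset {v} W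
      (by rw [Finset.disjoint_left]; simp [hW]) (fun i => by fun_prop)
    have hφ : Measurable fun f : (({v} : Finset ℕ) → ℝ × ℝ) => (f ⟨v, by simp⟩).1 := by fun_prop
    have hψ : Measurable fun (f : W → ℝ × ℝ) (w : W) => (f w).1 + (f w).2 := by fun_prop
    have h' := h.comp hφ hψ
    convert! h' using 1
    ext ω w
    simp [ringTime_succ]
  have hDm : MeasurableSet {q : ℝ × (W → ℝ) | ∀ w : W, q.1 < q.2 w} := by
    have : {q : ℝ × (W → ℝ) | ∀ w : W, q.1 < q.2 w} = ⋂ w : W, {q | q.1 < q.2 w} := by ext; simp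
    rw [this]
    exact .iInter fun w => measurableSet_lt (by fun_prop) (by fun_prop)
  have hset : recordEvent T (k + 1) 1 v =
      {ω | (T 0 v ω, fun w : W => ringTime T (k + 1) w ω) ∈
        {q : ℝ × (W → ℝ) | ∀ w : W, q.1 < q.2 w}} := by
    ext ω
    simp [recordEvent, ringTime_one, hW]
  rw [hset, measure_pair_mem (hT 0 v) hB hYB hDm, hlaw]
  refine lintegral_congr fun x => ?_
  have h1 : {ω | (x, fun w : W => ringTime T (k + 1) w ω) ∈
      {q : ℝ × (W → ℝ) | ∀ w : W, q.1 < q.2 w}} = {ω | ∀ w ∈ W, x < ringTime T (k + 1) w ω} := by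
    ext ω; simp
  rw [h1, measure_forall_lt_ringTime hT hlaw hind k W (fun _ => x),
    ENNReal.ofReal_pow (tail_nonneg _ _)]
  simp [hW]

end Probability

/-! ### Moments of the record count as integrals. -/

/-- The sum of `p ^ u * q ^ (v - 1 - u)` over all `u < v < n`. -/
noncomputable def pairSum (n : ℕ) (p q : ℝ) : ℝ :=
  ∑ v ∈ Finset.range n, ∑ u ∈ Finset.range v, p ^ u * q ^ (v - 1 - u)

lemma integral_expMeasure_one (f : ℝ → ℝ) :
    ∫ x, f x ∂(expMeasure 1) = ∫ x in Ioi 0, Real.exp (-x) * f x := by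
  rw [expMeasure_one_eq_withDensity, integral_withDensity_eq_integral_toReal_smul (by fun_prop)
    (ae_of_all _ fun _ => ENNReal.ofReal_lt_top)]
  simp [ENNReal.toReal_ofReal (Real.exp_pos _).le]

lemma integral_expMeasure_one_prod (f : ℝ × ℝ → ℝ) :
    ∫ z, f z ∂((expMeasure 1).prod (expMeasure 1)) =
      ∫ z in Ioi (0 : ℝ) ×ˢ Ioi (0 : ℝ), Real.exp (-z.1) * Real.exp (-z.2) * f z := by
  rw [expMeasure_one_eq_withDensity, prod_withDensity (by fun_prop) (by fun_prop),
    Measure.prod_restrict, ← Measure.volume_eq_prod,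
    integral_withDensity_eq_integral_toReal_smul (by fun_prop)
      (ae_of_all _ fun _ => ENNReal.mul_lt_top ENNReal.ofReal_lt_top ENNReal.ofReal_lt_top)]
  simp [ENNReal.toReal_ofReal (Real.exp_pos _).le]

section Moments

variable {Ω : Type*} [MeasurableSpace Ω] {P : Measure Ω} [IsProbabilityMeasure P]
  {T : ℕ → ℕ → Ω → ℝ}

omit [MeasurableSpace Ω] in
lemma recordCount_succ (T : ℕ → ℕ → Ω → ℝ) (k n r : ℕ) (ω : Ω) :
    recordCount T k (n + 1) r ω =
      recordCount T k n r ω + (recordEvent T k r n).indicator (fun _ => (1 : ℝ)) ω :=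
  Finset.sum_range_succ _ _

omit [MeasurableSpace Ω] in
/-- The second factorial moment variable counts the ordered pairs of distinct records. -/
lemma recordCount_mul_sub_one (T : ℕ → ℕ → Ω → ℝ) (k n r : ℕ) (ω : Ω) :
    recordCount T k n r ω * (recordCount T k n r ω - 1) =
      2 * ∑ v ∈ Finset.range n, ∑ u ∈ Finset.range v,
        (recordEvent T k r u ∩ recordEvent T k r v).indicator (fun _ => (1 : ℝ)) ω := by
  induction n with
  | zero => simp [recordCount]
  | succ n ih =>
    have h1 : ∑ u ∈ Finset.range n,
        (recordEvent T k r u ∩ recordEvent T k r n).indicator (fun _ => (1 : ℝ)) ω =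
        recordCount T k n r ω * (recordEvent T k r n).indicator (fun _ => (1 : ℝ)) ω := by
      rw [recordCount, Finset.sum_mul]
      refine Finset.sum_congr rfl fun u _ => ?_
      rw [← inter_indicator_mul]
      simp
    have h2 : (recordEvent T k r n).indicator (fun _ => (1 : ℝ)) ω *
        (recordEvent T k r n).indicator (fun _ => (1 : ℝ)) ω =
        (recordEvent T k r n).indicator (fun _ => (1 : ℝ)) ω := by
      rw [← inter_indicator_mul]
      simp
    rw [Finset.sum_range_succ, mul_add, ← ih, h1, recordCount_succ]
    linear_combination h2

variable (hT : ∀ i v, Measurable (T i v))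

include hT in
lemma measurable_recordCount (k n r : ℕ) : Measurable (recordCount T k n r) := by
  unfold recordCount
  exact Finset.measurable_sum _ fun v _ =>
    measurable_const.indicator (measurableSet_recordEvent hT k r v)

omit [MeasurableSpace Ω] in
lemma recordCount_nonneg (T : ℕ → ℕ → Ω → ℝ) (k n r : ℕ) (ω : Ω) : 0 ≤ recordCount T k n r ω :=
  Finset.sum_nonneg fun _ _ => indicator_nonneg (fun _ _ => zero_le_one) _

omit [MeasurableSpace Ω] in
lemma recordCount_le (T : ℕ → ℕ → Ω → ℝ) (k n r : ℕ) (ω : Ω) : recordCount T k n r ω ≤ n := by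
  refine (Finset.sum_le_sum fun v _ => indicator_le_self' (fun _ _ => zero_le_one) ω).trans ?_
  simp

include hT in
lemma memLp_recordCount (k n r : ℕ) : MemLp (recordCount T k n r) 2 P :=
  MemLp.of_bound (measurable_recordCount hT k n r).aestronglyMeasurable n
    (ae_of_all _ fun ω => by
      rw [Real.norm_of_nonneg (recordCount_nonneg T k n r ω)]
      exact recordCount_le T k n r ω)

variable (hlaw : ∀ i v, P.map (T i v) = expMeasure 1)
  (hind : iIndepFun (fun p : ℕ × ℕ => T p.1 p.2) P)

lemma toReal_lintegral_ofReal {α : Type*} [MeasurableSpace α] {μ : Measure α} {f : α → ℝ}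
    (hf : Measurable f) (h0 : ∀ x, 0 ≤ f x) :
    (∫⁻ x, ENNReal.ofReal (f x) ∂μ).toReal = ∫ x, f x ∂μ :=
  (integral_eq_lintegral_of_nonneg_ae (ae_of_all _ h0) hf.aestronglyMeasurable).symm

lemma integrable_of_mem_unitInterval {α : Type*} [MeasurableSpace α] {μ : Measure α}
    [IsFiniteMeasure μ] {f : α → ℝ} (hf : Measurable f) (h0 : ∀ x, 0 ≤ f x) (h1 : ∀ x, f x ≤ 1) :
    Integrable f μ :=
  Integrable.of_bound hf.aestronglyMeasurable 1
    (ae_of_all _ fun x => by rw [Real.norm_of_nonneg (h0 x)]; exact h1 x)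

include hT hlaw hind

lemma integral_recordCount (k n : ℕ) :
    ∫ ω, recordCount T (k + 1) n 1 ω ∂P =
      ∫ x in Ioi 0, Real.exp (-x) * ∑ v ∈ Finset.range n, tail (k + 1) x ^ v := by
  unfold recordCount
  rw [integral_finsetSum _ fun v _ => (integrable_const (1 : ℝ)).indicator
    (measurableSet_recordEvent hT _ _ v), ← integral_expMeasure_one, integral_finsetSum]
  · refine Finset.sum_congr rfl fun v _ => ?_
    rw [integral_indicator_const _ (measurableSet_recordEvent hT _ _ v), smul_eq_mul, mul_one,
      measureReal_def, measure_recordEvent hT hlaw hind, toReal_lintegral_ofReal (by fun_prop)]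
    exact fun x => pow_nonneg (tail_nonneg _ _) _
  · exact fun v _ => integrable_of_mem_unitInterval (by fun_prop)
      (fun x => pow_nonneg (tail_nonneg _ _) _)
      (fun x => pow_le_one₀ (tail_nonneg _ _) (tail_le_one _ _))

lemma integral_recordCount_mul_sub_one (k n : ℕ) :
    ∫ ω, recordCount T (k + 1) n 1 ω * (recordCount T (k + 1) n 1 ω - 1) ∂P =
      2 * ∫ z in Ioi (0 : ℝ) ×ˢ Ioi (0 : ℝ), Real.exp (-z.1) * Real.exp (-z.2) *
        (tail k (z.2 - z.1) * pairSum n (tail (k + 1) (max z.1 z.2)) (tail (k + 1) z.2)) := by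
  simp_rw [recordCount_mul_sub_one]
  have hms : ∀ u v, MeasurableSet (recordEvent T (k + 1) 1 u ∩ recordEvent T (k + 1) 1 v) :=
    fun u v => (measurableSet_recordEvent hT _ _ u).inter (measurableSet_recordEvent hT _ _ v)
  have hi : ∀ u v, Integrable
      ((recordEvent T (k + 1) 1 u ∩ recordEvent T (k + 1) 1 v).indicator (fun _ => (1 : ℝ))) P :=
    fun u v => (integrable_const (1 : ℝ)).indicator (hms u v)
  have h0 : ∀ (u v : ℕ) (z : ℝ × ℝ), 0 ≤ tail k (z.2 - z.1) *
      (tail (k + 1) (max z.1 z.2) ^ u * tail (k + 1) z.2 ^ (v - 1 - u)) := fun u v z =>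
    mul_nonneg (tail_nonneg _ _)
      (mul_nonneg (pow_nonneg (tail_nonneg _ _) _) (pow_nonneg (tail_nonneg _ _) _))
  have hi' : ∀ u v : ℕ, Integrable (fun z : ℝ × ℝ => tail k (z.2 - z.1) *
      (tail (k + 1) (max z.1 z.2) ^ u * tail (k + 1) z.2 ^ (v - 1 - u)))
      ((expMeasure 1).prod (expMeasure 1)) := fun u v => by
    refine integrable_of_mem_unitInterval (by fun_prop) (h0 u v) fun z => ?_
    refine mul_le_one₀ (tail_le_one _ _) (mul_nonneg (pow_nonneg (tail_nonneg _ _) _)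
      (pow_nonneg (tail_nonneg _ _) _)) ?_
    exact mul_le_one₀ (pow_le_one₀ (tail_nonneg _ _) (tail_le_one _ _))
      (pow_nonneg (tail_nonneg _ _) _) (pow_le_one₀ (tail_nonneg _ _) (tail_le_one _ _))
  rw [integral_const_mul, ← integral_expMeasure_one_prod]
  congr 1
  simp_rw [pairSum, Finset.mul_sum]
  rw [integral_finsetSum _ fun v _ => integrable_finsetSum _ fun u _ => hi u v,
    integral_finsetSum _ fun v _ => integrable_finsetSum _ fun u _ => hi' u v]
  refine Finset.sum_congr rfl fun v _ => ?_
  rw [integral_finsetSum _ fun u _ => hi u v, integral_finsetSum _ fun u _ => hi' u v]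
  refine Finset.sum_congr rfl fun u hu => ?_
  rw [integral_indicator_const _ (hms u v), smul_eq_mul, mul_one, measureReal_def,
    measure_recordEvent_inter hT hlaw hind k (Finset.mem_range.1 hu),
    toReal_lintegral_ofReal (by fun_prop) (h0 u v)]

end Moments

/-! ### Limit profiles of the one-node and two-node sums. -/

/-- The limit of `n⁻¹ ∑_{v<n} p ^ v` when `n (1 - p) → σ`. -/
noncomputable def expMean (σ : ℝ) : ℝ := (1 - Real.exp (-σ)) / σ

/-- The integral of `exp (-(a * σ + c * τ))` over the triangle `a, c ≥ 0`, `a + c ≤ 1`, written in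
the coordinates `a = ρ (1 - p)`, `c = ρ p`. -/
noncomputable def expPairMean (σ τ : ℝ) : ℝ :=
  ∫ ρ in (0 : ℝ)..1, ∫ p in (0 : ℝ)..1, ρ * Real.exp (-(ρ * ((1 - p) * σ + p * τ)))

lemma integral_exp_neg_mul {σ : ℝ} (hσ : σ ≠ 0) :
    ∫ ρ in (0 : ℝ)..1, Real.exp (-(ρ * σ)) = expMean σ := by
  have h : ∀ ρ ∈ uIcc (0 : ℝ) 1, HasDerivAt (fun ρ => -Real.exp (-(ρ * σ)) / σ)
      (Real.exp (-(ρ * σ))) ρ := by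
    intro ρ _
    have h1 : HasDerivAt (fun ρ => -(ρ * σ)) (-(1 * σ)) ρ := ((hasDerivAt_id ρ).mul_const σ).neg
    convert! (h1.exp.neg.div_const σ) using 1
    field_simp
  rw [intervalIntegral.integral_eq_sub_of_hasDerivAt h
    (Continuous.intervalIntegrable (by fun_prop) _ _), expMean]
  simp
  ring

/-- A divided difference of `expMean`, the continuous counterpart of `pairSum_mul_sub`. -/
lemma expPairMean_of_ne {σ τ : ℝ} (hσ : σ ≠ 0) (hτ : τ ≠ 0) (h : σ ≠ τ) :
    expPairMean σ τ = (expMean τ - expMean σ) / (σ - τ) := by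
  have hst : σ - τ ≠ 0 := sub_ne_zero.2 h
  have hin : ∀ ρ : ℝ, ∫ p in (0 : ℝ)..1, ρ * Real.exp (-(ρ * ((1 - p) * σ + p * τ))) =
      (Real.exp (-(ρ * τ)) - Real.exp (-(ρ * σ))) / (σ - τ) := by
    intro ρ
    have hd : ∀ p ∈ uIcc (0 : ℝ) 1, HasDerivAt
        (fun p => Real.exp (-(ρ * ((1 - p) * σ + p * τ))) / (σ - τ))
        (ρ * Real.exp (-(ρ * ((1 - p) * σ + p * τ)))) p := by
      intro p _
      have h1 : HasDerivAt (fun p => -(ρ * ((1 - p) * σ + p * τ)))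
          (-(ρ * (-1 * σ + 1 * τ))) p :=
        (((((hasDerivAt_id p).const_sub 1).mul_const σ).add
          ((hasDerivAt_id p).mul_const τ)).const_mul ρ).neg
      convert! (h1.exp.div_const (σ - τ)) using 1
      field_simp
      ring
    rw [intervalIntegral.integral_eq_sub_of_hasDerivAt hd
      (Continuous.intervalIntegrable (by fun_prop) _ _)]
    simp
    ring
  unfold expPairMean
  simp_rw [hin]
  rw [intervalIntegral.integral_div, intervalIntegral.integral_sub
    (Continuous.intervalIntegrable (by fun_prop) _ _)
    (Continuous.intervalIntegrable (by fun_prop) _ _), integral_exp_neg_mul hσ,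
    integral_exp_neg_mul hτ]

/-- The diagonal cannot be discarded as a null set: `max z.1 z.2 = z.2` on half of the quadrant. -/
lemma expPairMean_self {τ : ℝ} (hτ : τ ≠ 0) :
    expPairMean τ τ = (1 - Real.exp (-τ) - τ * Real.exp (-τ)) / τ ^ 2 := by
  have hin : ∀ ρ : ℝ, ∫ p in (0 : ℝ)..1, ρ * Real.exp (-(ρ * ((1 - p) * τ + p * τ))) =
      ρ * Real.exp (-(ρ * τ)) := by
    intro ρ
    have : ∀ p : ℝ, ρ * Real.exp (-(ρ * ((1 - p) * τ + p * τ))) = ρ * Real.exp (-(ρ * τ)) :=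
      fun p => by ring_nf
    simp_rw [this]
    simp
  unfold expPairMean
  simp_rw [hin]
  have hd : ∀ ρ ∈ uIcc (0 : ℝ) 1, HasDerivAt
      (fun ρ => -Real.exp (-(ρ * τ)) * (ρ / τ + 1 / τ ^ 2)) (ρ * Real.exp (-(ρ * τ))) ρ := by
    intro ρ _
    have h1 : HasDerivAt (fun ρ => -(ρ * τ)) (-(1 * τ)) ρ := ((hasDerivAt_id ρ).mul_const τ).neg
    have h2 : HasDerivAt (fun ρ => ρ / τ + 1 / τ ^ 2) (1 / τ) ρ :=
      ((hasDerivAt_id ρ).div_const τ).add_const _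
    convert! (h1.exp.neg.mul h2) using 1
    simp
    field_simp
    ring
  rw [intervalIntegral.integral_eq_sub_of_hasDerivAt hd
    (Continuous.intervalIntegrable (by fun_prop) _ _)]
  simp
  field_simp
  ring

/-! ### Limits of geometric sums and of `pairSum`. -/

section DiscreteLimits

lemma tendsto_one_of_tendsto_mul {p : ℕ → ℝ} {σ : ℝ}
    (h : Tendsto (fun n : ℕ => (n : ℝ) * (1 - p n)) atTop (𝓝 σ)) : Tendsto p atTop (𝓝 1) := by
  have h1 := h.mul (tendsto_inv_atTop_nhds_zero_nat (𝕜 := ℝ))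
  have h2 : Tendsto (fun n => 1 - p n) atTop (𝓝 0) := by
    rw [mul_zero] at h1
    refine h1.congr' ?_
    filter_upwards [eventually_gt_atTop 0] with n hn
    have : (n : ℝ) ≠ 0 := by positivity
    field_simp
  simpa using h2.const_sub 1

lemma tendsto_pow_exp {p : ℕ → ℝ} {σ : ℝ}
    (h : Tendsto (fun n : ℕ => (n : ℝ) * (1 - p n)) atTop (𝓝 σ)) :
    Tendsto (fun n => p n ^ n) atTop (𝓝 (Real.exp (-σ))) := by
  have h1 : Tendsto (fun n : ℕ => (n : ℝ) * (p n - 1)) atTop (𝓝 (-σ)) :=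
    h.neg.congr fun n => by ring
  simpa using Real.tendsto_one_add_pow_exp_of_tendsto h1

lemma tendsto_geom_mean {p : ℕ → ℝ} {σ : ℝ} (hσ : σ ≠ 0)
    (h : Tendsto (fun n : ℕ => (n : ℝ) * (1 - p n)) atTop (𝓝 σ)) :
    Tendsto (fun n : ℕ => (n : ℝ)⁻¹ * ∑ v ∈ Finset.range n, p n ^ v) atTop (𝓝 (expMean σ)) := by
  refine (((tendsto_pow_exp h).const_sub 1).div h hσ).congr' ?_
  filter_upwards [h.eventually_ne hσ] with n hn
  have h1 : (n : ℝ) ≠ 0 := left_ne_zero_of_mul hn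
  have h2 : 1 - p n ≠ 0 := right_ne_zero_of_mul hn
  have := mul_neg_geom_sum (p n) n
  rw [Pi.div_apply, ← this]
  field_simp

lemma pairSum_mul_sub (n : ℕ) (p q : ℝ) :
    pairSum n p q * (p - q) = ∑ v ∈ Finset.range n, p ^ v - ∑ v ∈ Finset.range n, q ^ v := by
  rw [pairSum, Finset.sum_mul, ← Finset.sum_sub_distrib]
  exact Finset.sum_congr rfl fun v _ => (Commute.all p q).geom_sum₂_mul v

/-- The additional factor `p` turns each `p ^ (v - 1)` into `p ^ v`, which keeps truncated
subtraction out of the formula. -/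
lemma pairSum_self (n : ℕ) (p : ℝ) :
    (1 - p) ^ 2 * (p * pairSum n p p) = p * (1 - p ^ n) - n * (1 - p) * p ^ n := by
  induction n with
  | zero => simp [pairSum]
  | succ n ih =>
    have h : p * ∑ u ∈ Finset.range n, p ^ u * p ^ (n - 1 - u) = n * p ^ n := by
      rw [Finset.mul_sum, Finset.sum_congr rfl (g := fun _ => p ^ n)]
      · simp
      · intro u hu
        have := Finset.mem_range.1 hu
        rw [← pow_add, ← pow_succ']
        congr 1
        omega
    have h2 : pairSum (n + 1) p p =
        pairSum n p p + ∑ u ∈ Finset.range n, p ^ u * p ^ (n - 1 - u) :=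
      Finset.sum_range_succ _ _
    rw [h2, mul_add p, mul_add, ih, h]
    push_cast
    ring

lemma tendsto_pairSum_of_ne {p q : ℕ → ℝ} {σ τ : ℝ} (hσ : σ ≠ 0) (hτ : τ ≠ 0) (hne : σ ≠ τ)
    (hp : Tendsto (fun n : ℕ => (n : ℝ) * (1 - p n)) atTop (𝓝 σ))
    (hq : Tendsto (fun n : ℕ => (n : ℝ) * (1 - q n)) atTop (𝓝 τ)) :
    Tendsto (fun n : ℕ => ((n : ℝ) ^ 2)⁻¹ * pairSum n (p n) (q n)) atTop
      (𝓝 (expPairMean σ τ)) := by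
  rw [expPairMean_of_ne hσ hτ hne]
  have hst : σ - τ ≠ 0 := sub_ne_zero.2 hne
  have hd := hp.sub hq
  refine (((tendsto_geom_mean hτ hq).sub (tendsto_geom_mean hσ hp)).div hd hst).congr' ?_
  filter_upwards [hd.eventually_ne hst, eventually_gt_atTop 0] with n hn h0
  have h1 : (n : ℝ) ≠ 0 := by positivity
  have h2 : q n - p n ≠ 0 := fun h => hn (by linear_combination (n : ℝ) * h)
  have h3 : (n : ℝ) * (1 - p n) - n * (1 - q n) = n * (q n - p n) := by ring
  rw [Pi.div_apply, h3, ← mul_sub, ← neg_sub (∑ v ∈ Finset.range n, p n ^ v), ← pairSum_mul_sub]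
  field_simp
  ring

lemma tendsto_pairSum_self {p : ℕ → ℝ} {τ : ℝ} (hτ : τ ≠ 0)
    (hp : Tendsto (fun n : ℕ => (n : ℝ) * (1 - p n)) atTop (𝓝 τ)) :
    Tendsto (fun n : ℕ => ((n : ℝ) ^ 2)⁻¹ * pairSum n (p n) (p n)) atTop
      (𝓝 (expPairMean τ τ)) := by
  have h1 := tendsto_one_of_tendsto_mul hp
  have hpow := tendsto_pow_exp hp
  have hlim := ((h1.mul (hpow.const_sub 1)).sub (hp.mul hpow)).div ((hp.pow 2).mul h1)
    (by simpa using hτ)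
  rw [expPairMean_self hτ]
  simp only [one_mul, mul_one] at hlim
  refine hlim.congr' ?_
  filter_upwards [hp.eventually_ne hτ, h1.eventually_ne one_ne_zero] with n hn hpn
  have hn1 : (n : ℝ) ≠ 0 := left_ne_zero_of_mul hn
  have hn2 : 1 - p n ≠ 0 := right_ne_zero_of_mul hn
  rw [Pi.div_apply, ← pairSum_self]
  field_simp

/-- The hypothesis `hpq` excludes distinct sequences with a common limit, so the two closed forms
cover every case. In the application, equal limits force equal arguments of `tail`. -/
lemma tendsto_pairSum {p q : ℕ → ℝ} {σ τ : ℝ} (hσ : σ ≠ 0) (hτ : τ ≠ 0)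
    (hpq : σ = τ → p = q)
    (hp : Tendsto (fun n : ℕ => (n : ℝ) * (1 - p n)) atTop (𝓝 σ))
    (hq : Tendsto (fun n : ℕ => (n : ℝ) * (1 - q n)) atTop (𝓝 τ)) :
    Tendsto (fun n : ℕ => ((n : ℝ) ^ 2)⁻¹ * pairSum n (p n) (q n)) atTop
      (𝓝 (expPairMean σ τ)) := by
  by_cases h : σ = τ
  · obtain rfl := hpq h
    obtain rfl := h
    exact tendsto_pairSum_self hτ hq
  · exact tendsto_pairSum_of_ne hσ hτ h hp hq

lemma pairSum_nonneg (n : ℕ) {p q : ℝ} (hp : 0 ≤ p) (hq : 0 ≤ q) : 0 ≤ pairSum n p q :=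
  Finset.sum_nonneg fun _ _ => Finset.sum_nonneg fun _ _ => by positivity

/-- The map from `(u, v)` to `(u, v - 1 - u)` embeds the triangle of indices into the square, whose
sum factors. -/
lemma pairSum_le (n : ℕ) {p q : ℝ} (hp : 0 ≤ p) (hq : 0 ≤ q) :
    pairSum n p q ≤ (∑ v ∈ Finset.range n, p ^ v) * ∑ v ∈ Finset.range n, q ^ v := by
  have h : pairSum n p q =
      ∑ u ∈ Finset.range n, ∑ v ∈ Finset.Ico (u + 1) n, p ^ u * q ^ (v - 1 - u) := by
    refine Finset.sum_comm' fun v u => ?_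
    simp only [Finset.mem_range, Finset.mem_Ico]
    omega
  rw [h, Finset.sum_mul]
  refine Finset.sum_le_sum fun u _ => ?_
  rw [← Finset.mul_sum, Finset.sum_Ico_eq_sum_range]
  refine mul_le_mul_of_nonneg_left ?_ (by positivity)
  rw [Finset.sum_congr rfl (g := fun i => q ^ i) fun i _ => by congr 1; omega]
  exact Finset.sum_le_sum_of_subset_of_nonneg (Finset.range_mono (Nat.sub_le _ _))
    fun _ _ _ => by positivity

end DiscreteLimits

/-! ### Rescaling and dominated convergence. -/

section Scaling

/-- The spatial scale `n ^ (1 / k)`. -/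
noncomputable def scale (k n : ℕ) : ℝ := (n : ℝ) ^ (1 / (k : ℝ))

lemma scale_nonneg (k n : ℕ) : 0 ≤ scale k n := by unfold scale; positivity

lemma scale_pos (k : ℕ) {n : ℕ} (hn : 0 < n) : 0 < scale k n := by unfold scale; positivity

lemma scale_pow {k : ℕ} (hk : k ≠ 0) (n : ℕ) : scale k n ^ k = n := by
  rw [scale, ← Real.rpow_natCast, ← Real.rpow_mul (by positivity)]
  field_simp
  simp

lemma tendsto_scale {k : ℕ} (hk : k ≠ 0) : Tendsto (scale k) atTop atTop :=
  (tendsto_rpow_atTop (by positivity)).comp tendsto_natCast_atTop_atTop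

lemma tendsto_div_scale {k : ℕ} (hk : k ≠ 0) (s : ℝ) :
    Tendsto (fun n => s / scale k n) atTop (𝓝 0) :=
  (tendsto_scale hk).const_div_atTop s

lemma mul_div_scale_pow {k : ℕ} (hk : k ≠ 0) {n : ℕ} (hn : 0 < n) (s : ℝ) :
    (n : ℝ) * (s / scale k n) ^ k = s ^ k := by
  rw [div_pow, scale_pow hk]
  have : (n : ℝ) ≠ 0 := by positivity
  field_simp

lemma tendsto_mul_one_sub_tail {k : ℕ} (hk : k ≠ 0) {s : ℝ} (hs : 0 ≤ s) :
    Tendsto (fun n : ℕ => (n : ℝ) * (1 - tail k (s / scale k n))) atTop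
      (𝓝 (s ^ k / k.factorial)) := by
  have h1 : Tendsto (fun n : ℕ => Real.exp (-(s / scale k n)) * (s ^ k / k.factorial)) atTop
      (𝓝 (s ^ k / k.factorial)) := by
    simpa using ((tendsto_div_scale hk s).neg.rexp).mul_const (s ^ k / (k.factorial : ℝ))
  refine tendsto_of_tendsto_of_tendsto_of_le_of_le' h1 tendsto_const_nhds ?_ ?_
  · filter_upwards [eventually_gt_atTop 0] with n hn
    have hx : 0 ≤ s / scale k n := div_nonneg hs (scale_nonneg k n)
    rw [← mul_div_scale_pow hk hn s]
    calc _ = (n : ℝ) * (Real.exp (-(s / scale k n)) *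
          ((s / scale k n) ^ k / k.factorial)) := by ring
      _ ≤ _ := mul_le_mul_of_nonneg_left (le_one_sub_tail k hx) (by positivity)
  · filter_upwards [eventually_gt_atTop 0] with n hn
    have hx : 0 ≤ s / scale k n := div_nonneg hs (scale_nonneg k n)
    rw [← mul_div_scale_pow hk hn s, mul_div_assoc]
    exact mul_le_mul_of_nonneg_left (one_sub_tail_le k hx) (by positivity)

/-- A two-sided limit is needed, since the difference of two first ring times may have either sign.
-/
lemma tendsto_tail_zero {k : ℕ} (hk : k ≠ 0) : Tendsto (tail k) (𝓝 0) (𝓝 1) := by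
  have h1 : Tendsto (fun x : ℝ => 1 - |x| ^ k / k.factorial) (𝓝 0) (𝓝 1) := by
    have : Continuous (fun x : ℝ => 1 - |x| ^ k / k.factorial) := by fun_prop
    simpa [hk] using this.tendsto 0
  refine tendsto_of_tendsto_of_tendsto_of_le_of_le h1 tendsto_const_nhds (fun x => ?_)
    (tail_le_one k)
  have h2 := one_sub_tail_le k (abs_nonneg x)
  have h3 := antitone_tail k (le_abs_self x)
  simp only
  linarith

/-- An integrable bound for the rescaled expected number of records. -/
noncomputable def scaleBound (k : ℕ) (s : ℝ) : ℝ := 2 * k.factorial * (1 + s ^ 2)⁻¹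

lemma integrable_scaleBound (k : ℕ) : Integrable (scaleBound k) :=
  integrable_inv_one_add_sq.const_mul _

lemma scaleBound_nonneg (k : ℕ) (s : ℝ) : 0 ≤ scaleBound k s := by unfold scaleBound; positivity

/-- For `s ≤ 1` the mean of the powers is at most `1`. For `s ≥ 1` the geometric sum is at most `1 /
(1 - p)`, and the exponential in front cancels the one lost in `le_one_sub_tail`, leaving `k! / s ^
k`, hence at most `k! / s ^ 2`. -/
lemma exp_mul_geom_mean_le {k : ℕ} (hk : 2 ≤ k) (n : ℕ) {s : ℝ} (hs : 0 < s) :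
    Real.exp (-(s / scale k n)) *
      ((n : ℝ)⁻¹ * ∑ v ∈ Finset.range n, tail k (s / scale k n) ^ v) ≤ scaleBound k s := by
  rcases Nat.eq_zero_or_pos n with rfl | hn
  · simpa using scaleBound_nonneg k s
  have hk0 : k ≠ 0 := by omega
  have hn0 : (0 : ℝ) < n := by positivity
  have hx : 0 < s / scale k n := div_pos hs (scale_pos k hn)
  have hf : (1 : ℝ) ≤ k.factorial := by exact_mod_cast k.factorial_pos
  set p := tail k (s / scale k n) with hp
  have hp0 : 0 ≤ p := tail_nonneg _ _
  have hp1 : p ≤ 1 := tail_le_one _ _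
  have hG0 : 0 ≤ ∑ v ∈ Finset.range n, p ^ v := Finset.sum_nonneg fun _ _ => by positivity
  rcases le_total s 1 with h1 | h1
  · have hG : ∑ v ∈ Finset.range n, p ^ v ≤ n := by
      refine (Finset.sum_le_sum fun v _ => pow_le_one₀ hp0 hp1).trans ?_
      simp
    calc _ ≤ 1 * ((n : ℝ)⁻¹ * n) := by
          gcongr
          exact Real.exp_le_one_iff.2 (by linarith)
      _ = 1 := by field_simp
      _ ≤ _ := by
          unfold scaleBound
          rw [← div_eq_mul_inv, le_div_iff₀ (by positivity)]
          nlinarith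
  · have hgeo : (1 - p) * ∑ v ∈ Finset.range n, p ^ v ≤ 1 := by
      rw [mul_neg_geom_sum]
      linarith [pow_nonneg hp0 n]
    have hlow := mul_le_mul_of_nonneg_right (le_one_sub_tail k hx.le) hG0
    have hsk : Real.exp (-(s / scale k n)) *
        ((n : ℝ)⁻¹ * ∑ v ∈ Finset.range n, p ^ v) * s ^ k ≤ k.factorial := by
      have e : Real.exp (-(s / scale k n)) *
        ((n : ℝ)⁻¹ * ∑ v ∈ Finset.range n, p ^ v) * s ^ k =
          k.factorial * (Real.exp (-(s / scale k n)) * ((s / scale k n) ^ k / k.factorial) *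
            ∑ v ∈ Finset.range n, p ^ v) := by
        rw [← mul_div_scale_pow hk0 hn s]
        field_simp
      rw [e]
      exact mul_le_of_le_one_right (by positivity) (hlow.trans hgeo)
    have hpow : s ^ 2 ≤ s ^ k := pow_le_pow_right₀ h1 hk
    unfold scaleBound
    rw [← div_eq_mul_inv, le_div_iff₀ (by positivity)]
    have hE : 0 ≤ Real.exp (-(s / scale k n)) * ((n : ℝ)⁻¹ * ∑ v ∈ Finset.range n, p ^ v) := by
      positivity
    have h2 := mul_le_mul_of_nonneg_left hpow hE
    have h3 := mul_le_mul_of_nonneg_left (one_le_pow₀ h1 (n := k)) hE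
    linarith

/-- Convergence of the rescaled first moment. -/
lemma tendsto_first_moment {k : ℕ} (hk : 2 ≤ k) :
    Tendsto (fun n : ℕ => (scale k n / n) *
      ∫ x in Ioi 0, Real.exp (-x) * ∑ v ∈ Finset.range n, tail k x ^ v) atTop
      (𝓝 (∫ s in Ioi 0, expMean (s ^ k / k.factorial))) := by
  have hk0 : k ≠ 0 := by omega
  have hlim : Tendsto (fun n : ℕ => ∫ s in Ioi (0 : ℝ), Real.exp (-(s / scale k n)) *
      ((n : ℝ)⁻¹ * ∑ v ∈ Finset.range n, tail k (s / scale k n) ^ v)) atTop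
      (𝓝 (∫ s in Ioi 0, expMean (s ^ k / k.factorial))) := by
    refine tendsto_integral_of_dominated_convergence (scaleBound k) (fun n => ?_)
      (integrable_scaleBound k).integrableOn (fun n => ?_) ?_
    · exact Measurable.aestronglyMeasurable (by fun_prop)
    · refine (ae_restrict_iff' measurableSet_Ioi).2 (ae_of_all _ fun s hs => ?_)
      rw [Real.norm_of_nonneg]
      · exact exp_mul_geom_mean_le hk n hs
      · have := tail_nonneg k (s / scale k n)
        have : 0 ≤ ∑ v ∈ Finset.range n, tail k (s / scale k n) ^ v :=
          Finset.sum_nonneg fun _ _ => by positivity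
        positivity
    · refine (ae_restrict_iff' measurableSet_Ioi).2 (ae_of_all _ fun s hs => ?_)
      have hs0 : 0 < s := hs
      have h1 : s ^ k / (k.factorial : ℝ) ≠ 0 := by positivity
      simpa using ((tendsto_div_scale hk0 s).neg.rexp).mul
        (tendsto_geom_mean h1 (tendsto_mul_one_sub_tail hk0 hs0.le))
  refine hlim.congr' ?_
  filter_upwards [eventually_gt_atTop 0] with n hn
  have hsc := scale_pos k hn
  -- Substitution `x = s / scale k n`.
  have h := integral_comp_mul_left_Ioi
    (fun x => Real.exp (-x) * ((n : ℝ)⁻¹ * ∑ v ∈ Finset.range n, tail k x ^ v)) 0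
    (inv_pos.2 hsc)
  simp only [mul_zero, inv_inv, smul_eq_mul] at h
  simp_rw [div_eq_inv_mul _ (scale k n)]
  rw [h, div_eq_mul_inv, mul_assoc, ← integral_const_mul (n : ℝ)⁻¹]
  congr 1
  refine integral_congr_ae (ae_of_all _ fun x => ?_)
  simp only
  ring

/-- The limiting density of pairs of records. -/
noncomputable def pairDensity (k : ℕ) (z : ℝ × ℝ) : ℝ :=
  expPairMean (max z.1 z.2 ^ k / k.factorial) (z.2 ^ k / k.factorial)

lemma rescaled_pair_nonneg (k n : ℕ) (z : ℝ × ℝ) :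
    0 ≤ Real.exp (-(z.1 / scale k n)) * Real.exp (-(z.2 / scale k n)) *
      (tail (k - 1) ((z.2 - z.1) / scale k n) * (((n : ℝ) ^ 2)⁻¹ *
        pairSum n (tail k (max z.1 z.2 / scale k n)) (tail k (z.2 / scale k n)))) := by
  have h1 := tail_nonneg (k - 1) ((z.2 - z.1) / scale k n)
  have h2 := pairSum_nonneg n (tail_nonneg k (max z.1 z.2 / scale k n))
    (tail_nonneg k (z.2 / scale k n))
  positivity

/-- Dropping the factor `tail (k - 1)` and replacing the maximum by `z.1`, which only increases the
tail, decouples the two variables. -/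
lemma rescaled_pair_le {k : ℕ} (hk : 2 ≤ k) (n : ℕ) {z : ℝ × ℝ}
    (hz : z ∈ Ioi (0 : ℝ) ×ˢ Ioi (0 : ℝ)) :
    Real.exp (-(z.1 / scale k n)) * Real.exp (-(z.2 / scale k n)) *
      (tail (k - 1) ((z.2 - z.1) / scale k n) * (((n : ℝ) ^ 2)⁻¹ *
        pairSum n (tail k (max z.1 z.2 / scale k n)) (tail k (z.2 / scale k n)))) ≤
      scaleBound k z.1 * scaleBound k z.2 := by
  have hG : ∀ p : ℝ, 0 ≤ p → 0 ≤ ∑ v ∈ Finset.range n, p ^ v := fun p hp =>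
    Finset.sum_nonneg fun _ _ => by positivity
  have h1 := tail_le_one (k - 1) ((z.2 - z.1) / scale k n)
  have h2 := pairSum_le n (tail_nonneg k (max z.1 z.2 / scale k n))
    (tail_nonneg k (z.2 / scale k n))
  have h2' := pairSum_nonneg n (tail_nonneg k (max z.1 z.2 / scale k n))
    (tail_nonneg k (z.2 / scale k n))
  have h3 : tail k (max z.1 z.2 / scale k n) ≤ tail k (z.1 / scale k n) :=
    antitone_tail k (div_le_div_of_nonneg_right (le_max_left _ _) (scale_nonneg k n))
  have h4 : pairSum n (tail k (max z.1 z.2 / scale k n)) (tail k (z.2 / scale k n)) ≤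
      (∑ v ∈ Finset.range n, tail k (z.1 / scale k n) ^ v) *
        ∑ v ∈ Finset.range n, tail k (z.2 / scale k n) ^ v := by
    refine h2.trans (mul_le_mul_of_nonneg_right ?_ (hG _ (tail_nonneg _ _)))
    exact Finset.sum_le_sum fun v _ => pow_le_pow_left₀ (tail_nonneg _ _) h3 v
  have h5 := exp_mul_geom_mean_le hk n hz.1
  have h6 := exp_mul_geom_mean_le hk n hz.2
  have hG1 := hG _ (tail_nonneg k (z.1 / scale k n))
  have hG2 := hG _ (tail_nonneg k (z.2 / scale k n))
  calc _ ≤ Real.exp (-(z.1 / scale k n)) * Real.exp (-(z.2 / scale k n)) *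
      (1 * (((n : ℝ) ^ 2)⁻¹ * ((∑ v ∈ Finset.range n, tail k (z.1 / scale k n) ^ v) *
        ∑ v ∈ Finset.range n, tail k (z.2 / scale k n) ^ v))) := by gcongr
    _ = (Real.exp (-(z.1 / scale k n)) *
        ((n : ℝ)⁻¹ * ∑ v ∈ Finset.range n, tail k (z.1 / scale k n) ^ v)) *
        (Real.exp (-(z.2 / scale k n)) *
        ((n : ℝ)⁻¹ * ∑ v ∈ Finset.range n, tail k (z.2 / scale k n) ^ v)) := by ring
    _ ≤ _ := mul_le_mul h5 h6 (by positivity) (scaleBound_nonneg _ _)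

lemma tendsto_rescaled_pair {k : ℕ} (hk : 2 ≤ k) {z : ℝ × ℝ}
    (hz : z ∈ Ioi (0 : ℝ) ×ˢ Ioi (0 : ℝ)) :
    Tendsto (fun n => Real.exp (-(z.1 / scale k n)) * Real.exp (-(z.2 / scale k n)) *
      (tail (k - 1) ((z.2 - z.1) / scale k n) * (((n : ℝ) ^ 2)⁻¹ *
        pairSum n (tail k (max z.1 z.2 / scale k n)) (tail k (z.2 / scale k n))))) atTop
      (𝓝 (pairDensity k z)) := by
  have hk0 : k ≠ 0 := by omega
  have h1 : 0 < z.1 := hz.1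
  have h2 : 0 < z.2 := hz.2
  have hm : 0 < max z.1 z.2 := lt_max_of_lt_left h1
  have hpair := tendsto_pairSum (σ := max z.1 z.2 ^ k / k.factorial) (τ := z.2 ^ k / k.factorial)
    (p := fun n => tail k (max z.1 z.2 / scale k n)) (q := fun n => tail k (z.2 / scale k n))
    (by positivity) (by positivity) (fun h => by
      have hf : (k.factorial : ℝ) ≠ 0 := by positivity
      have h3 : max z.1 z.2 ^ k = z.2 ^ k := by field_simp at h; exact h
      rw [(pow_left_inj₀ hm.le h2.le hk0).1 h3])
    (tendsto_mul_one_sub_tail hk0 hm.le) (tendsto_mul_one_sub_tail hk0 h2.le)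
  -- This uses `k ≥ 2`: for `k - 1 = 0` the tail would be an indicator, not continuous at `0`.
  have ht := (tendsto_tail_zero (k := k - 1) (by omega)).comp
    (tendsto_div_scale hk0 (z.2 - z.1))
  simpa [pairDensity] using (((tendsto_div_scale hk0 z.1).neg.rexp).mul
    ((tendsto_div_scale hk0 z.2).neg.rexp)).mul (ht.mul hpair)

lemma integrable_scaleBound_prod (k : ℕ) :
    IntegrableOn (fun z : ℝ × ℝ => scaleBound k z.1 * scaleBound k z.2)
      (Ioi (0 : ℝ) ×ˢ Ioi (0 : ℝ)) :=
  ((integrable_scaleBound k).mul_prod (integrable_scaleBound k)).integrableOn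

lemma pairDensity_nonneg {k : ℕ} (hk : 2 ≤ k) {z : ℝ × ℝ}
    (hz : z ∈ Ioi (0 : ℝ) ×ˢ Ioi (0 : ℝ)) : 0 ≤ pairDensity k z :=
  ge_of_tendsto' (tendsto_rescaled_pair hk hz) fun n => rescaled_pair_nonneg k n z

lemma pairDensity_le {k : ℕ} (hk : 2 ≤ k) {z : ℝ × ℝ}
    (hz : z ∈ Ioi (0 : ℝ) ×ˢ Ioi (0 : ℝ)) :
    pairDensity k z ≤ scaleBound k z.1 * scaleBound k z.2 :=
  le_of_tendsto' (tendsto_rescaled_pair hk hz) fun n => rescaled_pair_le hk n hz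

lemma measurable_rescaled_pair (k n : ℕ) : Measurable fun z : ℝ × ℝ =>
    Real.exp (-(z.1 / scale k n)) * Real.exp (-(z.2 / scale k n)) *
      (tail (k - 1) ((z.2 - z.1) / scale k n) * (((n : ℝ) ^ 2)⁻¹ *
        pairSum n (tail k (max z.1 z.2 / scale k n)) (tail k (z.2 / scale k n)))) := by
  unfold pairSum
  fun_prop

lemma aestronglyMeasurable_pairDensity {k : ℕ} (hk : 2 ≤ k) :
    AEStronglyMeasurable (pairDensity k)
      (volume.restrict (Ioi (0 : ℝ) ×ˢ Ioi (0 : ℝ))) :=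
  aestronglyMeasurable_of_tendsto_ae atTop
    (fun n => (measurable_rescaled_pair k n).aestronglyMeasurable)
    ((ae_restrict_iff' (measurableSet_Ioi.prod measurableSet_Ioi)).2
      (ae_of_all _ fun _ hz => tendsto_rescaled_pair hk hz))

lemma integrableOn_pairDensity {k : ℕ} (hk : 2 ≤ k) :
    IntegrableOn (pairDensity k) (Ioi (0 : ℝ) ×ˢ Ioi (0 : ℝ)) := by
  refine Integrable.mono' (integrable_scaleBound_prod k) (aestronglyMeasurable_pairDensity hk) ?_
  refine (ae_restrict_iff' (measurableSet_Ioi.prod measurableSet_Ioi)).2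
    (ae_of_all _ fun z hz => ?_)
  rw [Real.norm_of_nonneg (pairDensity_nonneg hk hz)]
  exact pairDensity_le hk hz

/-- Convergence of the rescaled second factorial moment. -/
lemma tendsto_pair_moment {k : ℕ} (hk : 2 ≤ k) :
    Tendsto (fun n : ℕ => (scale k n / n) ^ 2 *
      ∫ z in Ioi (0 : ℝ) ×ˢ Ioi (0 : ℝ), Real.exp (-z.1) * Real.exp (-z.2) *
        (tail (k - 1) (z.2 - z.1) * pairSum n (tail k (max z.1 z.2)) (tail k z.2))) atTop
      (𝓝 (∫ z in Ioi (0 : ℝ) ×ˢ Ioi (0 : ℝ), pairDensity k z)) := by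
  have hms : MeasurableSet (Ioi (0 : ℝ) ×ˢ Ioi (0 : ℝ)) := measurableSet_Ioi.prod measurableSet_Ioi
  have hlim : Tendsto (fun n : ℕ => ∫ z in Ioi (0 : ℝ) ×ˢ Ioi (0 : ℝ),
      Real.exp (-(z.1 / scale k n)) * Real.exp (-(z.2 / scale k n)) *
      (tail (k - 1) ((z.2 - z.1) / scale k n) * (((n : ℝ) ^ 2)⁻¹ *
        pairSum n (tail k (max z.1 z.2 / scale k n)) (tail k (z.2 / scale k n))))) atTop
      (𝓝 (∫ z in Ioi (0 : ℝ) ×ˢ Ioi (0 : ℝ), pairDensity k z)) := by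
    refine tendsto_integral_of_dominated_convergence
      (fun z => scaleBound k z.1 * scaleBound k z.2)
      (fun n => (measurable_rescaled_pair k n).aestronglyMeasurable)
      (integrable_scaleBound_prod k) (fun n => ?_) ?_
    · refine (ae_restrict_iff' hms).2 (ae_of_all _ fun z hz => ?_)
      rw [Real.norm_of_nonneg (rescaled_pair_nonneg k n z)]
      exact rescaled_pair_le hk n hz
    · exact (ae_restrict_iff' hms).2 (ae_of_all _ fun z hz => tendsto_rescaled_pair hk hz)
  refine hlim.congr' ?_
  filter_upwards [eventually_gt_atTop 0] with n hn
  have hsc := scale_pos k hn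
  set F : ℝ × ℝ → ℝ := fun z => Real.exp (-z.1) * Real.exp (-z.2) *
    (tail (k - 1) (z.2 - z.1) * pairSum n (tail k (max z.1 z.2)) (tail k z.2)) with hF
  -- The quadrant is invariant under dilation, and the Jacobian in dimension two is the square of
  -- the scale.
  have h := Measure.setIntegral_comp_smul_of_pos (volume : Measure (ℝ × ℝ)) F
    (Ioi (0 : ℝ) ×ˢ Ioi (0 : ℝ)) (inv_pos.2 hsc)
  have hset : (scale k n)⁻¹ • (Ioi (0 : ℝ) ×ˢ Ioi (0 : ℝ)) = Ioi (0 : ℝ) ×ˢ Ioi (0 : ℝ) := by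
    ext z
    rw [mem_smul_set_iff_inv_smul_mem₀ (inv_pos.2 hsc).ne']
    simp [hsc]
  rw [hset] at h
  simp only [Module.finrank_prod, Module.finrank_self, smul_eq_mul, inv_pow, inv_inv] at h
  rw [div_pow, div_eq_mul_inv, mul_comm (scale k n ^ 2), mul_assoc]
  rw [show (1 + 1 : ℕ) = 2 from rfl] at h
  rw [← h, ← integral_const_mul]
  refine setIntegral_congr_fun hms fun z _ => ?_
  have hmax : max (z.1 / scale k n) (z.2 / scale k n) = max z.1 z.2 / scale k n :=
    (max_div_div_right hsc.le _ _)
  simp only [hF, Prod.smul_fst, Prod.smul_snd, smul_eq_mul, ← div_eq_inv_mul, hmax, sub_div]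
  ring

end Scaling

/-! ### Series for the cotangent and logarithm integrals. -/

section Series

/-- Euler's partial fractions of the cotangent, regrouped by shifting one family of poles. The bound
`x ≤ 1 / 2` makes all terms nonnegative, so convergence of partial sums suffices. -/
lemma hasSum_pi_mul_cot {x : ℝ} (hx0 : 0 < x) (hx : x ≤ 1 / 2) :
    HasSum (fun j : ℕ => 1 / ((j : ℝ) + x) - 1 / ((j : ℝ) + 1 - x))
      (Real.pi * Real.cot (Real.pi * x)) := by
  have hmem : (x : ℂ) ∈ Complex.integerComplement := by
    rintro ⟨m, hm⟩
    have hm' : (m : ℝ) = x := by exact_mod_cast hm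
    have h1 : (0 : ℝ) < m := by rw [hm']; exact hx0
    have h2 : (m : ℝ) < 1 := by rw [hm']; linarith
    have h3 : 0 < m := by exact_mod_cast h1
    have h4 : m < 1 := by exact_mod_cast h2
    omega
  have hre : Tendsto (fun n : ℕ => ∑ j ∈ Finset.range n,
      (1 / (x - ((j : ℝ) + 1)) + 1 / (x + ((j : ℝ) + 1)))) atTop
      (𝓝 (Real.pi * Real.cot (Real.pi * x) - 1 / x)) := by
    have h := tendsto_logDeriv_euler_cot_sub hmem
    have h2 := (Complex.continuous_re.tendsto _).comp h
    have e : (Real.pi * Complex.cot (Real.pi * x) - 1 / (x : ℂ)) =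
        ((Real.pi * Real.cot (Real.pi * x) - 1 / x : ℝ) : ℂ) := by
      push_cast
      rfl
    rw [e, Complex.ofReal_re] at h2
    refine h2.congr fun n => ?_
    simp only [Function.comp_apply]
    rw [← Complex.ofReal_re (∑ j ∈ Finset.range n,
      (1 / (x - ((j : ℝ) + 1)) + 1 / (x + ((j : ℝ) + 1))))]
    congr 1
    push_cast
    rfl
  rw [hasSum_iff_tendsto_nat_of_nonneg]
  · have hz : Tendsto (fun n : ℕ => 1 / ((n : ℝ) + x)) atTop (𝓝 0) :=
      (tendsto_atTop_add_const_right _ _ tendsto_natCast_atTop_atTop).const_div_atTop 1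
    have := (hre.const_add (1 / x)).sub hz
    have e : 1 / x + (Real.pi * Real.cot (Real.pi * x) - 1 / x) - 0 =
      Real.pi * Real.cot (Real.pi * x) := by ring
    rw [e] at this
    refine this.congr fun n => ?_
    induction n with
    | zero => simp
    | succ n ih =>
      rw [Finset.sum_range_succ, Finset.sum_range_succ, ← ih]
      have h1 : (n : ℝ) + 1 - x ≠ 0 := by
        have : (0 : ℝ) ≤ n := by positivity
        linarith
      have h2 : x - ((n : ℝ) + 1) ≠ 0 := fun h => h1 (by linarith)
      have h3 : 1 / (x - ((n : ℝ) + 1)) = - (1 / ((n : ℝ) + 1 - x)) := by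
        rw [← neg_sub, div_neg]
      rw [h3]
      push_cast
      ring
  · intro j
    have : (0 : ℝ) ≤ j := by positivity
    rw [sub_nonneg]
    exact one_div_le_one_div_of_le (by positivity) (by linarith)

lemma hasSum_inv_odd_sq :
    HasSum (fun j : ℕ => 1 / (2 * (j : ℝ) + 1) ^ 2) (Real.pi ^ 2 / 8) := by
  have h := hasSum_zeta_two
  -- The even terms are a quarter of `π ^ 2 / 6`, so the odd ones sum to `π ^ 2 / 6 - π ^ 2 / 24`.
  have heven : HasSum (fun j : ℕ => 1 / (((2 * j : ℕ) : ℝ)) ^ 2) (Real.pi ^ 2 / 24) := by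
    convert! h.mul_left (1 / 4) using 1
    · ext j
      push_cast
      ring
    · ring
  have hodd : Summable (fun j : ℕ => 1 / (((2 * j + 1 : ℕ) : ℝ)) ^ 2) :=
    h.summable.comp_injective (i := fun j : ℕ => 2 * j + 1) fun a b hab => by simpa using hab
  have hs := (heven.even_add_odd (f := fun n : ℕ => 1 / (n : ℝ) ^ 2) hodd.hasSum).unique h
  have e : ∑' j : ℕ, 1 / (((2 * j + 1 : ℕ) : ℝ)) ^ 2 = Real.pi ^ 2 / 8 := by linarith
  have := hodd.hasSum
  rw [e] at this
  simpa using this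

lemma lintegral_ofReal_of_hasSum {α : Type*} [MeasurableSpace α] {μ : Measure α}
    {f : ℕ → α → ℝ} {F : α → ℝ} {a : ℕ → ℝ} {A : ℝ} (hf : ∀ j, Measurable (f j))
    (h0 : ∀ᵐ x ∂μ, ∀ j, 0 ≤ f j x) (hF : ∀ᵐ x ∂μ, HasSum (fun j => f j x) (F x))
    (ha : ∀ j, 0 ≤ a j) (hfa : ∀ j, ∫⁻ x, ENNReal.ofReal (f j x) ∂μ = ENNReal.ofReal (a j))
    (hA : HasSum a A) : ∫⁻ x, ENNReal.ofReal (F x) ∂μ = ENNReal.ofReal A := by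
  have h1 : ∀ᵐ x ∂μ, ENNReal.ofReal (F x) = ∑' j, ENNReal.ofReal (f j x) := by
    filter_upwards [h0, hF] with x hx0 hx
    rw [← hx.tsum_eq, ENNReal.ofReal_tsum_of_nonneg hx0 hx.summable]
  rw [lintegral_congr_ae h1, lintegral_tsum fun j => (by fun_prop), ← hA.tsum_eq,
    ENNReal.ofReal_tsum_of_nonneg ha hA.summable]
  simp_rw [hfa]

lemma lintegral_Ioc_ofReal {f : ℝ → ℝ} {a b : ℝ} (hab : a ≤ b)
    (hf : IntervalIntegrable f volume a b) (h0 : ∀ x ∈ Ioc a b, 0 ≤ f x) :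
    ∫⁻ x in Ioc a b, ENNReal.ofReal (f x) = ENNReal.ofReal (∫ x in a..b, f x) := by
  rw [intervalIntegral.integral_of_le hab, ofReal_integral_eq_lintegral_ofReal]
  · exact (intervalIntegrable_iff_integrableOn_Ioc_of_le hab).1 hf
  · exact (ae_restrict_iff' measurableSet_Ioc).2 (ae_of_all _ h0)

lemma hasSum_pow_mul_of_lt_one {k : ℕ} (hk : k ≠ 0) {w : ℝ} (hw0 : 0 ≤ w) (hw1 : w < 1) (c : ℝ) :
    HasSum (fun j : ℕ => w ^ (k * j) * c) (c / (1 - w ^ k)) := by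
  have h := (hasSum_geometric_of_lt_one (pow_nonneg hw0 k) (pow_lt_one₀ hw0 hw1 hk)).mul_right c
  simp_rw [← pow_mul] at h
  rwa [inv_mul_eq_div] at h

/-- Expand `1 / (1 - w ^ k)` geometrically; the `j`-th term integrates to `1 / (kj + 1) - 1 / (kj +
k - 1)`, which is `1 / k` times the cotangent series at `x = 1 / k`. -/
lemma lintegral_cot_kernel {k : ℕ} (hk : 2 < k) :
    ∫⁻ w in Ioo (0 : ℝ) 1, ENNReal.ofReal ((1 - w ^ (k - 2)) / (1 - w ^ k)) =
      ENNReal.ofReal (Real.pi / k * Real.cot (Real.pi / k)) := by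
  have hk0 : (0 : ℝ) < k := by positivity
  have hk2 : (2 : ℝ) ≤ k := by exact_mod_cast hk.le
  refine lintegral_ofReal_of_hasSum (f := fun j w => w ^ (k * j) * (1 - w ^ (k - 2)))
    (a := fun j : ℕ => 1 / ((k : ℝ) * j + 1) - 1 / ((k : ℝ) * j + k - 1))
    (fun j => by fun_prop) ?_ ?_ ?_ ?_ ?_
  · refine (ae_restrict_iff' measurableSet_Ioo).2 (ae_of_all _ fun w hw j => ?_)
    have := pow_le_one₀ hw.1.le hw.2.le (n := k - 2)
    exact mul_nonneg (pow_nonneg hw.1.le _) (by linarith)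
  · exact (ae_restrict_iff' measurableSet_Ioo).2 (ae_of_all _ fun w hw =>
      hasSum_pow_mul_of_lt_one (by omega) hw.1.le hw.2 _)
  · intro j
    have : (0 : ℝ) ≤ k * j := by positivity
    rw [sub_nonneg]
    exact one_div_le_one_div_of_le (by positivity) (by linarith)
  · intro j
    rw [restrict_Ioo_eq_restrict_Ioc, lintegral_Ioc_ofReal zero_le_one
      (Continuous.intervalIntegrable (by fun_prop) _ _)]
    · congr 1
      have e : ∀ w : ℝ, w ^ (k * j) * (1 - w ^ (k - 2)) = w ^ (k * j) - w ^ (k * j + (k - 2)) :=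
        fun w => by rw [pow_add]; ring
      simp_rw [e]
      rw [intervalIntegral.integral_sub (Continuous.intervalIntegrable (by fun_prop) _ _)
        (Continuous.intervalIntegrable (by fun_prop) _ _), integral_pow, integral_pow]
      push_cast [Nat.cast_sub hk.le]
      simp
      ring
    · intro w hw
      have := pow_le_one₀ hw.1.le hw.2 (n := k - 2)
      exact mul_nonneg (pow_nonneg hw.1.le _) (by linarith)
  · have h := (hasSum_pi_mul_cot (x := 1 / k) (by positivity)
      (one_div_le_one_div_of_le two_pos hk2)).mul_left (1 / (k : ℝ))
    convert! h using 1
    · ext j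
      have h1 : (0 : ℝ) ≤ k * j := by positivity
      have h2 : (k : ℝ) * j + k - 1 ≠ 0 := by linarith
      have h3 : (j : ℝ) + 1 - 1 / k ≠ 0 := by
        intro h
        apply h2
        field_simp at h
        linarith
      have h4 : (j : ℝ) + 1 / k ≠ 0 := by positivity
      have e1 : (k : ℝ) * j + 1 = k * (j + 1 / k) := by field_simp
      have e2 : (k : ℝ) * j + k - 1 = k * (j + 1 - 1 / k) := by field_simp
      rw [e1, e2]
      field_simp
    · rw [mul_one_div]
      ring

lemma integral_pow_mul_neg_log (m : ℕ) :
    ∫ w in (0 : ℝ)..1, w ^ m * (-2 * Real.log w) = 2 * (1 / ((m : ℝ) + 1) ^ 2) := by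
  have hm : (m : ℝ) + 1 ≠ 0 := by positivity
  -- The primitive is written through `w * log w`, which is continuous at `0`, although the
  -- integrand need not be.
  have hd : ∀ w ∈ Ioo (0 : ℝ) 1, HasDerivAt (fun w => -2 * (w ^ m * (w * Real.log w) / (m + 1) -
      w ^ (m + 1) / (m + 1) ^ 2)) (w ^ m * (-2 * Real.log w)) w := by
    intro w hw
    have hw0 : w ≠ 0 := hw.1.ne'
    have h1 := (hasDerivAt_pow m w).mul (Real.hasDerivAt_mul_log hw0)
    have h2 := hasDerivAt_pow (m + 1) w
    convert! ((h1.div_const ((m : ℝ) + 1)).sub (h2.div_const (((m : ℝ) + 1) ^ 2))).const_mul (-2)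
      using 1
    rcases m with _ | m
    · simp
    · push_cast
      push_cast at hm
      field_simp
      ring
  have hc : Continuous (fun w : ℝ => -2 * (w ^ m * (w * Real.log w) / (m + 1) -
      w ^ (m + 1) / (m + 1) ^ 2)) := by
    have := Real.continuous_mul_log
    fun_prop
  rw [intervalIntegral.integral_eq_sub_of_hasDerivAt_of_le zero_le_one hc.continuousOn hd]
  · simp
  · exact (intervalIntegral.intervalIntegrable_log'.const_mul (-2)).continuousOn_mul
      (Continuous.continuousOn (by fun_prop))

lemma lintegral_log_kernel :
    ∫⁻ w in Ioo (0 : ℝ) 1, ENNReal.ofReal (-2 * Real.log w / (1 - w ^ 2)) =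
      ENNReal.ofReal (Real.pi ^ 2 / 4) := by
  have hlog : ∀ w : ℝ, 0 < w → w ≤ 1 → 0 ≤ -2 * Real.log w := fun w h0 h1 => by
    linarith [Real.log_nonpos h0.le h1]
  refine lintegral_ofReal_of_hasSum (f := fun j w => w ^ (2 * j) * (-2 * Real.log w))
    (a := fun j : ℕ => 2 * (1 / (2 * (j : ℝ) + 1) ^ 2))
    (fun j => by fun_prop) ?_ ?_ (fun j => by positivity) ?_ ?_
  · exact (ae_restrict_iff' measurableSet_Ioo).2 (ae_of_all _ fun w hw j =>
      mul_nonneg (pow_nonneg hw.1.le _) (hlog w hw.1 hw.2.le))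
  · exact (ae_restrict_iff' measurableSet_Ioo).2 (ae_of_all _ fun w hw =>
      hasSum_pow_mul_of_lt_one two_ne_zero hw.1.le hw.2 _)
  · intro j
    rw [restrict_Ioo_eq_restrict_Ioc, lintegral_Ioc_ofReal zero_le_one]
    · rw [integral_pow_mul_neg_log]
      push_cast
      rfl
    · exact (intervalIntegral.intervalIntegrable_log'.const_mul (-2)).continuousOn_mul
        (Continuous.continuousOn (by fun_prop))
    · exact fun w hw => mul_nonneg (pow_nonneg hw.1.le _) (hlog w hw.1 hw.2)
  · convert! hasSum_inv_odd_sq.mul_left 2 using 1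
    ring

end Series

/-! ### Evaluation of the limiting integrals. -/

section Evaluation

lemma lintegral_pow_mul_exp {k : ℕ} (hk : k ≠ 0) (m : ℕ) {b : ℝ} (hb : 0 < b) :
    ∫⁻ s in Ioi (0 : ℝ), ENNReal.ofReal (s ^ m * Real.exp (-(b * s ^ k))) =
      ENNReal.ofReal (b ^ (-((m : ℝ) + 1) / k) * (1 / k) * Real.Gamma (((m : ℝ) + 1) / k)) := by
  have hm : (-1 : ℝ) < m := by linarith [(Nat.cast_nonneg m : (0 : ℝ) ≤ m)]
  have hk' : (0 : ℝ) < k := by positivity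
  have h1 := integral_rpow_mul_exp_neg_mul_rpow hk' hm hb
  have h2 := integrableOn_rpow_mul_exp_neg_mul_rpow hm hk' hb
  simp only [Real.rpow_natCast, neg_mul] at h1 h2
  rw [← h1, ofReal_integral_eq_lintegral_ofReal h2]
  refine (ae_restrict_iff' measurableSet_Ioi).2 (ae_of_all _ fun s hs => ?_)
  have : 0 < s := hs
  simp only [Pi.zero_apply]
  positivity

lemma lintegral_Ioc_rpow {r : ℝ} (hr : -1 < r) :
    ∫⁻ ρ in Ioc (0 : ℝ) 1, ENNReal.ofReal (ρ ^ r) = ENNReal.ofReal (1 / (r + 1)) := by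
  rw [lintegral_Ioc_ofReal zero_le_one (intervalIntegral.intervalIntegrable_rpow' hr)
    fun x hx => Real.rpow_nonneg hx.1.le _, integral_rpow (Or.inl hr)]
  rw [Real.one_rpow, Real.zero_rpow (by linarith), sub_zero]

lemma expMean_nonneg {σ : ℝ} (hσ : 0 ≤ σ) : 0 ≤ expMean σ :=
  div_nonneg (sub_nonneg.2 (Real.exp_le_one_iff.2 (by linarith))) hσ

@[fun_prop]
lemma measurable_expMean : Measurable expMean := by
  unfold expMean
  fun_prop

/-- Write `expMean` as an integral over `ρ` and integrate `s` first: a Gamma integral leaves `ρ ^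
(-1 / k)`, whose integral is `k / (k - 1)`. -/
lemma integral_expMean {k : ℕ} (hk : 2 ≤ k) :
    ∫ s in Ioi (0 : ℝ), expMean (s ^ k / k.factorial) = eta k 1 := by
  have hk2 : (2 : ℝ) ≤ k := by exact_mod_cast hk
  have hk0 : k ≠ 0 := by omega
  have hf : (0 : ℝ) < k.factorial := by positivity
  have hG : 0 < Real.Gamma (1 / (k : ℝ)) := Real.Gamma_pos_of_pos (by positivity)
  have hkk : 1 / (k : ℝ) ≤ 1 / 2 := one_div_le_one_div_of_le two_pos hk2
  have key : ∫⁻ s in Ioi (0 : ℝ), ENNReal.ofReal (expMean (s ^ k / k.factorial)) =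
      ENNReal.ofReal (eta k 1) := by
    have h1 : ∫⁻ s in Ioi (0 : ℝ), ENNReal.ofReal (expMean (s ^ k / k.factorial)) =
        ∫⁻ s in Ioi (0 : ℝ), ∫⁻ ρ in Ioc (0 : ℝ) 1,
          ENNReal.ofReal (Real.exp (-(ρ * (s ^ k / k.factorial)))) := by
      refine setLIntegral_congr_fun measurableSet_Ioi fun s hs => ?_
      have : 0 < s := hs
      rw [lintegral_Ioc_ofReal zero_le_one (Continuous.intervalIntegrable (by fun_prop) _ _)
        fun _ _ => (Real.exp_pos _).le, integral_exp_neg_mul (by positivity)]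
    have h2 : ∀ ρ ∈ Ioc (0 : ℝ) 1, ∫⁻ s in Ioi (0 : ℝ),
        ENNReal.ofReal (Real.exp (-(ρ * (s ^ k / k.factorial)))) =
        ENNReal.ofReal ((k.factorial : ℝ) ^ (1 / (k : ℝ)) * (1 / k) * Real.Gamma (1 / k)) *
          ENNReal.ofReal (ρ ^ (-(1 / (k : ℝ)))) := by
      intro ρ hρ
      have hρ0 : 0 < ρ := hρ.1
      have h3 := lintegral_pow_mul_exp hk0 0 (b := ρ / k.factorial) (by positivity)
      simp only [pow_zero, one_mul, Nat.cast_zero, zero_add] at h3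
      rw [← ENNReal.ofReal_mul (by positivity)]
      convert h3 using 2
      · ext s
        ring_nf
      · rw [Real.div_rpow hρ0.le hf.le, neg_div, Real.rpow_neg hf.le]
        field_simp
    rw [h1, lintegral_lintegral_swap (Measurable.aemeasurable (by fun_prop)),
      setLIntegral_congr_fun measurableSet_Ioc h2, lintegral_const_mul _ (by fun_prop),
      lintegral_Ioc_rpow (by linarith), ← ENNReal.ofReal_mul (by positivity)]
    congr 1
    have hk1 : (k : ℝ) - 1 ≠ 0 := by linarith
    have hk1' : -(1 / (k : ℝ)) + 1 ≠ 0 := by linarith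
    have e : -(1 / (k : ℝ)) + 1 = (k - 1) / k := by field_simp; ring
    rw [eta, e]
    simp only [Nat.cast_one, Real.Gamma_one, div_one]
    field_simp
  rw [integral_eq_lintegral_of_nonneg_ae _ (Measurable.aestronglyMeasurable (by fun_prop)), key,
    ENNReal.toReal_ofReal]
  · rw [eta]
    have : 0 < (k : ℝ) - 1 := by linarith
    simp only [Nat.cast_one, Real.Gamma_one, div_one]
    positivity
  · refine (ae_restrict_iff' measurableSet_Ioi).2 (ae_of_all _ fun s hs => ?_)
    have : 0 < s := hs
    exact expMean_nonneg (by positivity)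

lemma continuous_expPairMean_inner (σ τ : ℝ) : Continuous fun ρ : ℝ =>
    ∫ p in (0 : ℝ)..1, ρ * Real.exp (-(ρ * ((1 - p) * σ + p * τ))) := by
  refine intervalIntegral.continuous_parametric_intervalIntegral_of_continuous' ?_ 0 1
  unfold Function.uncurry
  fun_prop

@[fun_prop]
lemma continuous_expPairMean : Continuous fun z : ℝ × ℝ => expPairMean z.1 z.2 := by
  unfold expPairMean
  refine intervalIntegral.continuous_parametric_intervalIntegral_of_continuous' ?_ 0 1
  refine intervalIntegral.continuous_parametric_intervalIntegral_of_continuous' ?_ 0 1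
  unfold Function.uncurry
  fun_prop

lemma continuous_pairDensity (k : ℕ) : Continuous (pairDensity k) := by
  have h : Continuous fun z : ℝ × ℝ =>
      ((max z.1 z.2 ^ k / (k.factorial : ℝ), z.2 ^ k / (k.factorial : ℝ)) : ℝ × ℝ) := by fun_prop
  exact continuous_expPairMean.comp h

lemma ofReal_expPairMean (σ τ : ℝ) :
    ENNReal.ofReal (expPairMean σ τ) =
      ∫⁻ q, ENNReal.ofReal (q.1 * Real.exp (-(q.1 * ((1 - q.2) * σ + q.2 * τ))))
        ∂((volume.restrict (Ioc (0 : ℝ) 1)).prod (volume.restrict (Ioc (0 : ℝ) 1))) := by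
  rw [lintegral_prod _ (Measurable.aemeasurable (by fun_prop)), expPairMean,
    ← lintegral_Ioc_ofReal zero_le_one
      ((continuous_expPairMean_inner σ τ).intervalIntegrable _ _)]
  · refine setLIntegral_congr_fun measurableSet_Ioc fun ρ hρ => ?_
    have : 0 < ρ := hρ.1
    simp only
    rw [lintegral_Ioc_ofReal zero_le_one (Continuous.intervalIntegrable (by fun_prop) _ _)]
    exact fun p _ => by positivity
  · intro ρ hρ
    have : 0 < ρ := hρ.1
    exact intervalIntegral.integral_nonneg zero_le_one fun p _ => by positivity

/-- Integrating `s` first gives `Γ(2/k) / k` times `(ρ c) ^ (-2 / k)` with `c = (1 - p) A + p B`.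
The weight `ρ` then makes the `ρ` integral equal to `k / (2 (k - 1))`. -/
lemma lintegral_mul_expPairMean {k : ℕ} (hk : 2 ≤ k) {A B : ℝ} (hA : 0 < A) (hB : 0 < B) :
    ∫⁻ s in Ioi (0 : ℝ), ENNReal.ofReal (s * expPairMean (A * s ^ k) (B * s ^ k)) =
      ENNReal.ofReal (Real.Gamma (2 / k) / (2 * ((k : ℝ) - 1))) *
        ∫⁻ p in Ioc (0 : ℝ) 1, ENNReal.ofReal (((1 - p) * A + p * B) ^ (-(2 / (k : ℝ)))) := by
  have hk2 : (2 : ℝ) ≤ k := by exact_mod_cast hk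
  have hk0 : k ≠ 0 := by omega
  have hG : 0 < Real.Gamma (2 / (k : ℝ)) := Real.Gamma_pos_of_pos (by positivity)
  have hkk : 2 / (k : ℝ) ≤ 1 := (div_le_one (by positivity)).2 hk2
  have h1 : ∫⁻ s in Ioi (0 : ℝ), ENNReal.ofReal (s * expPairMean (A * s ^ k) (B * s ^ k)) =
      ∫⁻ s in Ioi (0 : ℝ), ∫⁻ q, ENNReal.ofReal
        (s * (q.1 * Real.exp (-(q.1 * ((1 - q.2) * (A * s ^ k) + q.2 * (B * s ^ k))))))
        ∂((volume.restrict (Ioc (0 : ℝ) 1)).prod (volume.restrict (Ioc (0 : ℝ) 1))) := by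
    refine setLIntegral_congr_fun measurableSet_Ioi fun s hs => ?_
    have : 0 < s := hs
    rw [ENNReal.ofReal_mul this.le, ofReal_expPairMean, ← lintegral_const_mul _ (by fun_prop)]
    simp_rw [← ENNReal.ofReal_mul this.le]
  have h2 : ∀ q ∈ Ioc (0 : ℝ) 1 ×ˢ Ioc (0 : ℝ) 1, ∫⁻ s in Ioi (0 : ℝ), ENNReal.ofReal
        (s * (q.1 * Real.exp (-(q.1 * ((1 - q.2) * (A * s ^ k) + q.2 * (B * s ^ k)))))) =
      ENNReal.ofReal (1 / k * Real.Gamma (2 / k)) * (ENNReal.ofReal (q.1 ^ (1 - 2 / (k : ℝ))) *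
        ENNReal.ofReal (((1 - q.2) * A + q.2 * B) ^ (-(2 / (k : ℝ))))) := by
    rintro ⟨ρ, p⟩ ⟨hρ, hp⟩
    simp only at hρ hp ⊢
    have hρ0 : 0 < ρ := hρ.1
    have hc : 0 < (1 - p) * A + p * B :=
      add_pos_of_nonneg_of_pos (mul_nonneg (by linarith [hp.2]) hA.le) (mul_pos hp.1 hB)
    have h3 := lintegral_pow_mul_exp hk0 1 (b := ρ * ((1 - p) * A + p * B)) (by positivity)
    have h4 : ∀ s : ℝ, ENNReal.ofReal
        (s * (ρ * Real.exp (-(ρ * ((1 - p) * (A * s ^ k) + p * (B * s ^ k)))))) =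
        ENNReal.ofReal ρ * ENNReal.ofReal
          (s ^ 1 * Real.exp (-(ρ * ((1 - p) * A + p * B) * s ^ k))) := fun s => by
      rw [← ENNReal.ofReal_mul hρ0.le]
      ring_nf
    simp_rw [h4]
    rw [lintegral_const_mul _ (by fun_prop), h3, ← ENNReal.ofReal_mul hρ0.le,
      ← ENNReal.ofReal_mul (by positivity), ← ENNReal.ofReal_mul (by positivity)]
    congr 1
    have e : ((1 : ℕ) : ℝ) + 1 = 2 := by norm_num
    have e2 : ρ ^ (1 - 2 / (k : ℝ)) = ρ * ρ ^ (-(2 / (k : ℝ))) := by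
      rw [sub_eq_add_neg, Real.rpow_add hρ0, Real.rpow_one]
    rw [e, neg_div, Real.mul_rpow hρ0.le hc.le, e2]
    ring
  rw [h1, lintegral_lintegral_swap (Measurable.aemeasurable (by fun_prop)), Measure.prod_restrict,
    setLIntegral_congr_fun (measurableSet_Ioc.prod measurableSet_Ioc) h2,
    lintegral_const_mul _ (by fun_prop), ← Measure.prod_restrict,
    lintegral_prod_mul (f := fun ρ : ℝ => ENNReal.ofReal (ρ ^ (1 - 2 / (k : ℝ))))
      (g := fun p : ℝ => ENNReal.ofReal (((1 - p) * A + p * B) ^ (-(2 / (k : ℝ)))))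
      (Measurable.aemeasurable (by fun_prop)) (Measurable.aemeasurable (by fun_prop)),
    lintegral_Ioc_rpow (by linarith), ← mul_assoc, ← ENNReal.ofReal_mul (by positivity)]
  congr 2
  have hk1 : (k : ℝ) - 1 ≠ 0 := by linarith
  have e : 1 - 2 / (k : ℝ) + 1 = 2 * (k - 1) / k := by field_simp; ring
  rw [e]
  field_simp

/-- The value of `∫∫ (1 - p + p w ^ k) ^ (-2 / k)` over the unit square. -/
noncomputable def squareConst (k : ℕ) : ℝ :=
  if k = 2 then Real.pi ^ 2 / 4 else k / ((k : ℝ) - 2) * (Real.pi / k * Real.cot (Real.pi / k))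

lemma integral_affine_rpow {W r : ℝ} (hW : 0 < W) (hW1 : W < 1) (hr : r ≠ -1) :
    ∫ p in (0 : ℝ)..1, ((1 - p) * 1 + p * W) ^ r = (1 - W ^ (r + 1)) / ((r + 1) * (1 - W)) := by
  have hr' : r + 1 ≠ 0 := fun h => hr (by linarith)
  have hW' : 1 - W ≠ 0 := by linarith
  have hpos : ∀ p ∈ uIcc (0 : ℝ) 1, 0 < (1 - p) * 1 + p * W := by
    intro p hp
    rw [uIcc_of_le zero_le_one] at hp
    nlinarith [hp.1, hp.2]
  have hd : ∀ p ∈ uIcc (0 : ℝ) 1, HasDerivAt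
      (fun p => -(((1 - p) * 1 + p * W) ^ (r + 1)) / ((r + 1) * (1 - W)))
      (((1 - p) * 1 + p * W) ^ r) p := by
    intro p hp
    have h1 : HasDerivAt (fun p => (1 - p) * 1 + p * W) (-1 * 1 + 1 * W) p :=
      (((hasDerivAt_id p).const_sub 1).mul_const 1).add ((hasDerivAt_id p).mul_const W)
    convert! ((h1.rpow_const (p := r + 1) (Or.inl (hpos p hp).ne')).neg.div_const
      ((r + 1) * (1 - W))) using 1
    rw [add_sub_cancel_right]
    field_simp
    ring
  rw [intervalIntegral.integral_eq_sub_of_hasDerivAt hd]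
  · simp
    ring
  · refine ContinuousOn.intervalIntegrable fun p hp => ?_
    exact ContinuousAt.continuousWithinAt (ContinuousAt.rpow_const (by fun_prop)
      (Or.inl (hpos p hp).ne'))

lemma integral_affine_inv {W : ℝ} (hW : 0 < W) (hW1 : W < 1) :
    ∫ p in (0 : ℝ)..1, ((1 - p) * 1 + p * W) ^ (-1 : ℝ) = -Real.log W / (1 - W) := by
  have hW' : 1 - W ≠ 0 := by linarith
  have hpos : ∀ p ∈ uIcc (0 : ℝ) 1, 0 < (1 - p) * 1 + p * W := by
    intro p hp
    rw [uIcc_of_le zero_le_one] at hp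
    nlinarith [hp.1, hp.2]
  have hd : ∀ p ∈ uIcc (0 : ℝ) 1, HasDerivAt
      (fun p => -Real.log ((1 - p) * 1 + p * W) / (1 - W))
      (((1 - p) * 1 + p * W) ^ (-1 : ℝ)) p := by
    intro p hp
    have h0 := (hpos p hp).ne'
    have h1 : HasDerivAt (fun p => (1 - p) * 1 + p * W) (-1 * 1 + 1 * W) p :=
      (((hasDerivAt_id p).const_sub 1).mul_const 1).add ((hasDerivAt_id p).mul_const W)
    convert! ((h1.log h0).neg.div_const (1 - W)) using 1
    rw [Real.rpow_neg_one]
    field_simp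
    ring
  rw [intervalIntegral.integral_eq_sub_of_hasDerivAt hd]
  · simp
  · refine ContinuousOn.intervalIntegrable fun p hp => ?_
    exact ContinuousAt.continuousWithinAt (ContinuousAt.rpow_const (by fun_prop)
      (Or.inl (hpos p hp).ne'))

lemma lintegral_affine_rpow {W r : ℝ} (hW : 0 < W) (hW1 : W < 1) :
    ∫⁻ p in Ioc (0 : ℝ) 1, ENNReal.ofReal (((1 - p) * 1 + p * W) ^ r) =
      ENNReal.ofReal (∫ p in (0 : ℝ)..1, ((1 - p) * 1 + p * W) ^ r) := by
  have hpos : ∀ p ∈ Icc (0 : ℝ) 1, 0 < (1 - p) * 1 + p * W := by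
    intro p hp
    nlinarith [hp.1, hp.2]
  refine lintegral_Ioc_ofReal zero_le_one (ContinuousOn.intervalIntegrable fun p hp => ?_)
    fun p hp => Real.rpow_nonneg (hpos p ⟨hp.1.le, hp.2⟩).le _
  rw [uIcc_of_le zero_le_one] at hp
  exact ContinuousAt.continuousWithinAt (ContinuousAt.rpow_const (by fun_prop)
    (Or.inl (hpos p hp).ne'))

lemma pow_rpow_sub {k : ℕ} (hk : 2 ≤ k) {w : ℝ} (hw : 0 < w) :
    (w ^ k) ^ (-(2 / (k : ℝ)) + 1) = w ^ (k - 2) := by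
  have hk0 : (k : ℝ) ≠ 0 := by positivity
  rw [← Real.rpow_natCast, ← Real.rpow_mul hw.le, ← Real.rpow_natCast]
  congr 1
  push_cast [Nat.cast_sub hk]
  field_simp
  ring

lemma squareConst_nonneg {k : ℕ} (hk : 2 ≤ k) : 0 ≤ squareConst k := by
  unfold squareConst
  split_ifs with h
  · positivity
  · have hk3 : (3 : ℝ) ≤ k := by exact_mod_cast (show 3 ≤ k by omega)
    have h2 : 0 < (k : ℝ) - 2 := by linarith
    have hx0 : 0 < Real.pi / k := by positivity
    have hx1 : Real.pi / k ≤ Real.pi / 2 :=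
      div_le_div_of_nonneg_left Real.pi_pos.le two_pos (by linarith)
    have hc : 0 ≤ Real.cot (Real.pi / k) := by
      rw [Real.cot_eq_cos_div_sin]
      exact div_nonneg (Real.cos_nonneg_of_mem_Icc ⟨by linarith [Real.pi_pos], hx1⟩)
        (Real.sin_nonneg_of_nonneg_of_le_pi hx0.le (by linarith [Real.pi_pos]))
    positivity

/-- The exponent `-2 / k` equals `-1` only for `k = 2`; there the inner integral is a logarithm,
otherwise a power. -/
lemma lintegral_square {k : ℕ} (hk : 2 ≤ k) :
    ∫⁻ w in Ioo (0 : ℝ) 1, ∫⁻ p in Ioc (0 : ℝ) 1,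
      ENNReal.ofReal (((1 - p) * 1 + p * w ^ k) ^ (-(2 / (k : ℝ)))) =
      ENNReal.ofReal (squareConst k) := by
  have hk0 : k ≠ 0 := by omega
  unfold squareConst
  split_ifs with h2
  · subst h2
    rw [← lintegral_log_kernel]
    refine setLIntegral_congr_fun measurableSet_Ioo fun w hw => ?_
    have hW : 0 < w ^ 2 := pow_pos hw.1 2
    have hW1 : w ^ 2 < 1 := pow_lt_one₀ hw.1.le hw.2 two_ne_zero
    rw [lintegral_affine_rpow hW hW1]
    have e : -(2 / ((2 : ℕ) : ℝ)) = -1 := by norm_num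
    rw [e, integral_affine_inv hW hW1, Real.log_pow]
    norm_num
  · have hk3 : 2 < k := by omega
    have hk3' : (2 : ℝ) < k := by exact_mod_cast hk3
    have hk2 : (k : ℝ) - 2 ≠ 0 := by linarith
    rw [ENNReal.ofReal_mul (div_nonneg (by positivity) (by linarith)), ← lintegral_cot_kernel hk3,
      ← lintegral_const_mul _ (by fun_prop)]
    refine setLIntegral_congr_fun measurableSet_Ioo fun w hw => ?_
    have hW : 0 < w ^ k := pow_pos hw.1 k
    have hW1 : w ^ k < 1 := pow_lt_one₀ hw.1.le hw.2 hk0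
    have hr : -(2 / (k : ℝ)) ≠ -1 := by
      intro h
      have h' : 2 / (k : ℝ) = 1 := by linarith
      rw [div_eq_one_iff_eq (by positivity)] at h'
      linarith
    rw [lintegral_affine_rpow hW hW1, integral_affine_rpow hW hW1 hr, pow_rpow_sub hk hw.1,
      ← ENNReal.ofReal_mul (div_nonneg (by positivity) (by linarith))]
    congr 1
    have hW2 : 1 - w ^ k ≠ 0 := by linarith
    have e : -(2 / (k : ℝ)) + 1 = (k - 2) / k := by field_simp; ring
    rw [e]
    field_simp

lemma lintegral_Ioi_comp_mul {s : ℝ} (hs : 0 < s) (f : ℝ → ℝ≥0∞) :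
    ∫⁻ t in Ioi 0, f t = ∫⁻ w in Ioi 0, ENNReal.ofReal s * f (s * w) := by
  have himg : (fun w => s * w) '' Ioi 0 = Ioi 0 := by
    rw [image_mul_left_Ioi hs, mul_zero]
  have h := lintegral_image_eq_lintegral_abs_deriv_mul (s := Ioi (0 : ℝ)) (f := fun w => s * w)
    (f' := fun _ => s) measurableSet_Ioi
    (fun x _ => by simpa using ((hasDerivAt_id x).const_mul s).hasDerivWithinAt)
    (mul_right_injective₀ hs.ne').injOn f
  rw [himg] at h
  simpa [abs_of_pos hs] using h

/-- For `w ≥ 1` the base is `w ^ k` whatever `p` is, so the integrand is `w ^ (-2)`, with integral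
`1`. -/
lemma lintegral_max_affine {k : ℕ} (hk : 2 ≤ k) :
    ∫⁻ w in Ioi (0 : ℝ), ∫⁻ p in Ioc (0 : ℝ) 1,
      ENNReal.ofReal (((1 - p) * max 1 w ^ k + p * w ^ k) ^ (-(2 / (k : ℝ)))) =
      ENNReal.ofReal (1 + squareConst k) := by
  have hk0 : (k : ℝ) ≠ 0 := by positivity
  have hun : Ioi (0 : ℝ) = Ioo 0 1 ∪ Ici 1 := (Ioo_union_Ici_eq_Ioi zero_lt_one).symm
  rw [hun, lintegral_union measurableSet_Ici (by
    rw [Set.disjoint_left]; intro w hw hw'; exact absurd hw.2 (not_lt.2 hw')), add_comm,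
    ENNReal.ofReal_add zero_le_one (squareConst_nonneg hk)]
  congr 1
  · have h1 : ∀ w ∈ Ici (1 : ℝ), ∫⁻ p in Ioc (0 : ℝ) 1,
        ENNReal.ofReal (((1 - p) * max 1 w ^ k + p * w ^ k) ^ (-(2 / (k : ℝ)))) =
        ENNReal.ofReal (w ^ (-2 : ℝ)) := by
      intro w hw
      have hw1 : 1 ≤ w := hw
      have e : ∀ p : ℝ, (1 - p) * max 1 w ^ k + p * w ^ k = w ^ k := fun p => by
        rw [max_eq_right hw1]; ring
      have e2 : (w ^ k) ^ (-(2 / (k : ℝ))) = w ^ (-2 : ℝ) := by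
        rw [← Real.rpow_natCast, ← Real.rpow_mul (by linarith)]
        congr 1
        field_simp
      simp_rw [e, e2]
      simp
    rw [setLIntegral_congr_fun measurableSet_Ici h1, ← restrict_Ioi_eq_restrict_Ici,
      ← ofReal_integral_eq_lintegral_ofReal
        (integrableOn_Ioi_rpow_of_lt (by norm_num) zero_lt_one),
      integral_Ioi_rpow_of_lt (by norm_num) zero_lt_one]
    · norm_num
    · refine (ae_restrict_iff' measurableSet_Ioi).2 (ae_of_all _ fun w hw => ?_)
      have : (1 : ℝ) < w := hw
      exact Real.rpow_nonneg (by linarith) _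
  · rw [← lintegral_square hk]
    refine setLIntegral_congr_fun measurableSet_Ioo fun w hw => ?_
    rw [max_eq_left hw.2.le, one_pow]

lemma lintegral_pairDensity {k : ℕ} (hk : 2 ≤ k) :
    ∫⁻ z in Ioi (0 : ℝ) ×ˢ Ioi (0 : ℝ), ENNReal.ofReal (pairDensity k z) =
      ENNReal.ofReal (Real.Gamma (2 / k) * (k.factorial : ℝ) ^ (2 / (k : ℝ)) /
        (2 * ((k : ℝ) - 1)) * (1 + squareConst k)) := by
  have hk0 : k ≠ 0 := by omega
  have hk2 : (2 : ℝ) ≤ k := by exact_mod_cast hk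
  have hk1 : 0 < (k : ℝ) - 1 := by linarith
  have hf : (0 : ℝ) < k.factorial := by positivity
  have hG : 0 < Real.Gamma (2 / (k : ℝ)) := Real.Gamma_pos_of_pos (by positivity)
  have hpd := (continuous_pairDensity k).measurable
  -- Substituting `t = s * w` separates the radial variable `s` from the ratio `w`; the Jacobian
  -- supplies the weight `s`.
  have hscale : ∀ s ∈ Ioi (0 : ℝ), ∫⁻ t in Ioi (0 : ℝ), ENNReal.ofReal (pairDensity k (s, t)) =
      ∫⁻ w in Ioi (0 : ℝ), ENNReal.ofReal (s * expPairMean (max 1 w ^ k / k.factorial * s ^ k)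
        (w ^ k / k.factorial * s ^ k)) := by
    intro s hs
    have hs0 : 0 < s := hs
    rw [lintegral_Ioi_comp_mul hs0]
    refine lintegral_congr fun w => ?_
    rw [← ENNReal.ofReal_mul hs0.le, pairDensity]
    have e : max s (s * w) = s * max 1 w := by
      rw [mul_max_of_nonneg _ _ hs0.le, mul_one]
    simp only [e, mul_pow]
    congr 3 <;> ring
  have hcont : Continuous fun z : ℝ × ℝ => z.1 * expPairMean
      (max 1 z.2 ^ k / k.factorial * z.1 ^ k) (z.2 ^ k / k.factorial * z.1 ^ k) := by
    refine continuous_fst.mul ?_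
    have h : Continuous fun z : ℝ × ℝ => ((max 1 z.2 ^ k / (k.factorial : ℝ) * z.1 ^ k,
      z.2 ^ k / (k.factorial : ℝ) * z.1 ^ k) : ℝ × ℝ) := by fun_prop
    exact continuous_expPairMean.comp h
  have hinner : ∀ w ∈ Ioi (0 : ℝ), ∫⁻ s in Ioi (0 : ℝ),
      ENNReal.ofReal (s * expPairMean (max 1 w ^ k / k.factorial * s ^ k)
        (w ^ k / k.factorial * s ^ k)) =
      ENNReal.ofReal (Real.Gamma (2 / k) * (k.factorial : ℝ) ^ (2 / (k : ℝ)) /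
        (2 * ((k : ℝ) - 1))) * ∫⁻ p in Ioc (0 : ℝ) 1,
      ENNReal.ofReal (((1 - p) * max 1 w ^ k + p * w ^ k) ^ (-(2 / (k : ℝ)))) := by
    intro w hw
    have hw0 : 0 < w := hw
    have hm : 0 < max 1 w := lt_max_of_lt_left one_pos
    rw [lintegral_mul_expPairMean hk (by positivity) (by positivity),
      ← lintegral_const_mul _ (by fun_prop), ← lintegral_const_mul _ (by fun_prop)]
    refine setLIntegral_congr_fun measurableSet_Ioc fun p hp => ?_
    have hc : 0 ≤ (1 - p) * max 1 w ^ k + p * w ^ k :=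
      add_nonneg (mul_nonneg (by linarith [hp.2]) (by positivity))
        (mul_nonneg hp.1.le (by positivity))
    rw [← ENNReal.ofReal_mul (by positivity), ← ENNReal.ofReal_mul (by positivity)]
    have e : (1 - p) * (max 1 w ^ k / (k.factorial : ℝ)) + p * (w ^ k / k.factorial) =
      ((1 - p) * max 1 w ^ k + p * w ^ k) / k.factorial := by ring
    rw [e, Real.div_rpow hc hf.le, Real.rpow_neg hf.le]
    congr 1
    field_simp
  rw [Measure.volume_eq_prod, ← Measure.prod_restrict, lintegral_prod _
    (Measurable.aemeasurable (by fun_prop)), setLIntegral_congr_fun measurableSet_Ioi hscale,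
    lintegral_lintegral_swap (by
      exact (ENNReal.measurable_ofReal.comp hcont.measurable).aemeasurable),
    setLIntegral_congr_fun measurableSet_Ioi hinner, lintegral_const_mul,
    lintegral_max_affine hk, ← ENNReal.ofReal_mul (by positivity)]
  refine Measurable.lintegral_prod_right' (ν := volume.restrict (Ioc (0 : ℝ) 1))
    (f := fun q : ℝ × ℝ =>
      ENNReal.ofReal (((1 - q.2) * max 1 q.1 ^ k + q.2 * q.1 ^ k) ^ (-(2 / (k : ℝ))))) ?_
  fun_prop

lemma two_mul_integral_pairDensity {k : ℕ} (hk : 2 ≤ k) :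
    2 * ∫ z in Ioi (0 : ℝ) ×ˢ Ioi (0 : ℝ), pairDensity k z = gam k := by
  have hk2 : (2 : ℝ) ≤ k := by exact_mod_cast hk
  have hk1 : 0 < (k : ℝ) - 1 := by linarith
  have hG : 0 < Real.Gamma (2 / (k : ℝ)) := Real.Gamma_pos_of_pos (by positivity)
  have hJ := squareConst_nonneg hk
  rw [integral_eq_lintegral_of_nonneg_ae
    ((ae_restrict_iff' (measurableSet_Ioi.prod measurableSet_Ioi)).2
      (ae_of_all _ fun z hz => pairDensity_nonneg hk hz)) (aestronglyMeasurable_pairDensity hk),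
    lintegral_pairDensity hk, ENNReal.toReal_ofReal (by positivity)]
  unfold gam lam squareConst
  split_ifs with h
  · subst h
    norm_num
    ring
  · have h3 : (3 : ℝ) ≤ k := by exact_mod_cast (show 3 ≤ k by omega)
    have h2 : (k : ℝ) - 2 ≠ 0 := by linarith
    field_simp

end Evaluation

/-! ### Strict positivity of the limiting variance. -/

section Positivity

/-- The product is an integral of `exp (-(a σ + b τ))` over the unit square; cut along the diagonal
and set `b = a + c` or `a = b + c` on the two triangles. -/
lemma expMean_mul_expMean {σ τ : ℝ} (hσ : 0 < σ) (hτ : 0 < τ) :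
    expMean σ * expMean τ = expPairMean (σ + τ) τ + expPairMean (σ + τ) σ := by
  rw [expPairMean_of_ne (by positivity) hτ.ne' (by linarith),
    expPairMean_of_ne (by positivity) hσ.ne' (by linarith)]
  unfold expMean
  rw [neg_add, Real.exp_add, add_sub_cancel_right, add_sub_cancel_left]
  field_simp
  ring

lemma expPairMean_lt {σ σ' : ℝ} (τ : ℝ) (h : σ < σ') : expPairMean σ' τ < expPairMean σ τ := by
  have hle : ∀ ρ ∈ Icc (0 : ℝ) 1, ∀ p ∈ Icc (0 : ℝ) 1,
      ρ * Real.exp (-(ρ * ((1 - p) * σ' + p * τ))) ≤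
        ρ * Real.exp (-(ρ * ((1 - p) * σ + p * τ))) := by
    intro ρ hρ p hp
    refine mul_le_mul_of_nonneg_left (Real.exp_le_exp.2 (neg_le_neg ?_)) hρ.1
    refine mul_le_mul_of_nonneg_left ?_ hρ.1
    have := mul_le_mul_of_nonneg_left h.le (sub_nonneg.2 hp.2)
    linarith
  refine intervalIntegral.integral_lt_integral_of_continuousOn_of_le_of_exists_lt zero_lt_one
    (continuous_expPairMean_inner σ' τ).continuousOn
    (continuous_expPairMean_inner σ τ).continuousOn (fun ρ hρ => ?_)
    ⟨1, right_mem_Icc.2 zero_le_one, ?_⟩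
  · exact intervalIntegral.integral_mono_on zero_le_one
      (Continuous.intervalIntegrable (by fun_prop) _ _)
      (Continuous.intervalIntegrable (by fun_prop) _ _) fun p hp => hle ρ ⟨hρ.1.le, hρ.2⟩ p hp
  · refine intervalIntegral.integral_lt_integral_of_continuousOn_of_le_of_exists_lt zero_lt_one
      (Continuous.continuousOn (by fun_prop)) (Continuous.continuousOn (by fun_prop))
      (fun p hp => hle 1 (right_mem_Icc.2 zero_le_one) p ⟨hp.1.le, hp.2⟩)
      ⟨0, left_mem_Icc.2 zero_le_one, ?_⟩
    simpa using h

/-- Common ancestors need only outlast the later first ring, so the rate is the maximum of the two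
rates; independence would give their strictly larger sum. -/
lemma expMean_mul_expMean_lt (k : ℕ) {z : ℝ × ℝ}
    (hz : z ∈ Ioi (0 : ℝ) ×ˢ Ioi (0 : ℝ)) :
    expMean (z.1 ^ k / k.factorial) * expMean (z.2 ^ k / k.factorial) <
      pairDensity k z + pairDensity k z.swap := by
  have h1 : 0 < z.1 := hz.1
  have h2 : 0 < z.2 := hz.2
  have hlt : max z.1 z.2 ^ k / (k.factorial : ℝ) <
      z.1 ^ k / k.factorial + z.2 ^ k / k.factorial := by
    rw [← add_div]
    refine div_lt_div_of_pos_right ?_ (by positivity)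
    rcases max_choice z.1 z.2 with h | h <;> rw [h]
    · linarith [pow_pos h2 k]
    · linarith [pow_pos h1 k]
  rw [expMean_mul_expMean (by positivity) (by positivity)]
  refine add_lt_add (expPairMean_lt _ hlt) ?_
  simp only [pairDensity, Prod.fst_swap, Prod.snd_swap, max_comm z.2 z.1]
  exact expPairMean_lt _ hlt

lemma integrableOn_expMean {k : ℕ} (hk : 2 ≤ k) :
    IntegrableOn (fun s : ℝ => expMean (s ^ k / k.factorial)) (Ioi 0) := by
  refine Integrable.mono' (integrable_scaleBound k).integrableOn
    (Measurable.aestronglyMeasurable (by fun_prop)) ?_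
  refine (ae_restrict_iff' measurableSet_Ioi).2 (ae_of_all _ fun s hs => ?_)
  have hs0 : 0 < s := hs
  have hk0 : k ≠ 0 := by omega
  rw [Real.norm_of_nonneg (expMean_nonneg (by positivity))]
  have h := ((tendsto_div_scale hk0 s).neg.rexp).mul
    (tendsto_geom_mean (by positivity) (tendsto_mul_one_sub_tail hk0 hs0.le))
  simp only [neg_zero, Real.exp_zero, one_mul] at h
  exact le_of_tendsto' h fun n => exp_mul_geom_mean_le hk n hs0

/-- The limiting variance is positive. -/
lemma eta_sq_lt_gam {k : ℕ} (hk : 2 ≤ k) : eta k 1 ^ 2 < gam k := by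
  set Q : Set (ℝ × ℝ) := Ioi (0 : ℝ) ×ˢ Ioi (0 : ℝ) with hQ
  have hQm : MeasurableSet Q := measurableSet_Ioi.prod measurableSet_Ioi
  have hvol : (volume : Measure (ℝ × ℝ)).restrict Q =
      (volume.restrict (Ioi (0 : ℝ))).prod (volume.restrict (Ioi (0 : ℝ))) := by
    rw [Measure.prod_restrict, ← Measure.volume_eq_prod]
  have hswap : ∫ z in Q, pairDensity k z.swap = ∫ z in Q, pairDensity k z := by
    rw [hvol]
    exact integral_prod_swap _
  have hint : IntegrableOn (fun z : ℝ × ℝ => pairDensity k z.swap) Q := by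
    have := integrableOn_pairDensity hk
    rw [IntegrableOn, ← hQ, hvol] at *
    exact this.swap
  have hintf : IntegrableOn (fun z : ℝ × ℝ =>
      expMean (z.1 ^ k / k.factorial) * expMean (z.2 ^ k / k.factorial)) Q := by
    rw [IntegrableOn, hvol]
    exact (integrableOn_expMean hk).mul_prod (integrableOn_expMean hk)
  have hsq : eta k 1 ^ 2 = ∫ z in Q,
      expMean (z.1 ^ k / k.factorial) * expMean (z.2 ^ k / k.factorial) := by
    rw [hvol, integral_prod_mul (fun s : ℝ => expMean (s ^ k / k.factorial))
      (fun s : ℝ => expMean (s ^ k / k.factorial)), integral_expMean hk, sq]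
  -- Symmetrising the pair density absorbs the factor `2` and makes it comparable with the product
  -- pointwise.
  have hgam : gam k = ∫ z in Q, (pairDensity k z + pairDensity k z.swap) := by
    rw [integral_add (integrableOn_pairDensity hk) hint, hswap,
      ← two_mul_integral_pairDensity hk, two_mul]
  have hadd : IntegrableOn (fun z : ℝ × ℝ => pairDensity k z + pairDensity k z.swap) Q :=
    (integrableOn_pairDensity hk).add hint
  rw [← sub_pos, hsq, hgam, ← integral_sub hadd hintf,
    setIntegral_pos_iff_support_of_nonneg_ae _ (by exact hadd.sub hintf)]
  · have hsub : Q ⊆ Function.support (fun z : ℝ × ℝ => pairDensity k z + pairDensity k z.swap -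
        expMean (z.1 ^ k / k.factorial) * expMean (z.2 ^ k / k.factorial)) := fun z hz =>
      (sub_pos.2 (expMean_mul_expMean_lt k hz)).ne'
    rw [inter_eq_self_of_subset_right hsub, hQ, Measure.volume_eq_prod, Measure.prod_prod]
    simp
  · exact (ae_restrict_iff' hQm).2
      (ae_of_all _ fun z hz => (sub_pos.2 (expMean_mul_expMean_lt k hz)).le)

lemma gam_pos {k : ℕ} (hk : 2 ≤ k) : 0 < gam k := (sq_nonneg _).trans_lt (eta_sq_lt_gam hk)

end Positivity

/-! ### Asymptotics of the moments and the variance. -/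

section Asymptotics

variable {Ω : Type*} [MeasurableSpace Ω] {P : Measure Ω} [IsProbabilityMeasure P]
  {T : ℕ → ℕ → Ω → ℝ}

lemma scale_div_eq_rpow {k n : ℕ} (hn : 0 < n) :
    scale k n / n = ((n : ℝ) ^ (1 - 1 / (k : ℝ)))⁻¹ := by
  have : (0 : ℝ) < n := by positivity
  rw [scale, Real.rpow_sub this, Real.rpow_one, inv_div]

lemma rpow_one_sub_sq (k n : ℕ) :
    ((n : ℝ) ^ (1 - 1 / (k : ℝ))) ^ 2 = (n : ℝ) ^ (2 - 2 / (k : ℝ)) := by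
  rw [← Real.rpow_natCast, ← Real.rpow_mul (by positivity)]
  congr 1
  push_cast
  ring

lemma tendsto_integral_recordCount (hT : ∀ i v, Measurable (T i v))
    (hlaw : ∀ i v, P.map (T i v) = expMeasure 1)
    (hind : iIndepFun (fun p : ℕ × ℕ => T p.1 p.2) P) {k : ℕ} (hk : 2 ≤ k) :
    Tendsto (fun n : ℕ => (∫ ω, recordCount T k n 1 ω ∂P) / (n : ℝ) ^ (1 - 1 / (k : ℝ))) atTop
      (𝓝 (eta k 1)) := by
  have h := tendsto_first_moment hk
  rw [integral_expMean hk] at h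
  obtain ⟨m, rfl⟩ : ∃ m, k = m + 1 := ⟨k - 1, by omega⟩
  refine h.congr' ?_
  filter_upwards [eventually_gt_atTop 0] with n hn
  rw [scale_div_eq_rpow hn, integral_recordCount hT hlaw hind, inv_mul_eq_div]

lemma tendsto_integral_recordCount_mul_sub_one (hT : ∀ i v, Measurable (T i v))
    (hlaw : ∀ i v, P.map (T i v) = expMeasure 1)
    (hind : iIndepFun (fun p : ℕ × ℕ => T p.1 p.2) P) {k : ℕ} (hk : 2 ≤ k) :
    Tendsto (fun n : ℕ => (∫ ω, recordCount T k n 1 ω * (recordCount T k n 1 ω - 1) ∂P) /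
      (n : ℝ) ^ (2 - 2 / (k : ℝ))) atTop (𝓝 (gam k)) := by
  have h := (tendsto_pair_moment hk).const_mul 2
  rw [two_mul_integral_pairDensity hk] at h
  obtain ⟨m, rfl⟩ : ∃ m, k = m + 1 := ⟨k - 1, by omega⟩
  refine h.congr' ?_
  filter_upwards [eventually_gt_atTop 0] with n hn
  rw [scale_div_eq_rpow hn, integral_recordCount_mul_sub_one hT hlaw hind, inv_pow,
    rpow_one_sub_sq, Nat.add_sub_cancel]
  ring

lemma tendsto_integral_recordCount_sq (hT : ∀ i v, Measurable (T i v))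
    (hlaw : ∀ i v, P.map (T i v) = expMeasure 1)
    (hind : iIndepFun (fun p : ℕ × ℕ => T p.1 p.2) P) {k : ℕ} (hk : 2 ≤ k) :
    Tendsto (fun n : ℕ => (∫ ω, recordCount T k n 1 ω ^ 2 ∂P) / (n : ℝ) ^ (2 - 2 / (k : ℝ)))
      atTop (𝓝 (gam k)) := by
  have hk2 : (2 : ℝ) ≤ k := by exact_mod_cast hk
  have hkk : 1 / (k : ℝ) ≤ 1 / 2 := one_div_le_one_div_of_le two_pos hk2
  have h1 := tendsto_integral_recordCount_mul_sub_one hT hlaw hind hk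
  have h2 := tendsto_integral_recordCount hT hlaw hind hk
  have h3 : Tendsto (fun n : ℕ => ((n : ℝ) ^ (1 - 1 / (k : ℝ)))⁻¹) atTop (𝓝 0) :=
    tendsto_inv_atTop_zero.comp
      ((tendsto_rpow_atTop (by linarith)).comp tendsto_natCast_atTop_atTop)
  -- Adding the mean to the factorial moment gives the second moment; the mean is smaller by a
  -- factor of order `n ^ (1 - 1 / k)`.
  have h4 := h1.add (h2.mul h3)
  rw [mul_zero, add_zero] at h4
  refine h4.congr fun n => ?_
  have hL := memLp_recordCount (P := P) hT k n 1
  have hi := hL.integrable one_le_two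
  have e : ∀ ω, recordCount T k n 1 ω * (recordCount T k n 1 ω - 1) =
      recordCount T k n 1 ω ^ 2 - recordCount T k n 1 ω := fun ω => by ring
  simp_rw [e]
  rw [integral_sub hL.integrable_sq hi, ← rpow_one_sub_sq]
  ring

lemma tendsto_variance_recordCount (hT : ∀ i v, Measurable (T i v))
    (hlaw : ∀ i v, P.map (T i v) = expMeasure 1)
    (hind : iIndepFun (fun p : ℕ × ℕ => T p.1 p.2) P) {k : ℕ} (hk : 2 ≤ k) :
    Tendsto (fun n : ℕ => variance (recordCount T k n 1) P / (n : ℝ) ^ (2 - 2 / (k : ℝ)))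
      atTop (𝓝 (gam k - eta k 1 ^ 2)) := by
  refine ((tendsto_integral_recordCount_sq hT hlaw hind hk).sub
    ((tendsto_integral_recordCount hT hlaw hind hk).pow 2)).congr fun n => ?_
  rw [variance_eq_sub (memLp_recordCount hT k n 1), div_pow, rpow_one_sub_sq, ← sub_div]
  rfl

lemma isEquivalent_const_mul_of_tendsto_div {u b : ℕ → ℝ} {c : ℝ} (hc : c ≠ 0)
    (h : Tendsto (fun n => u n / b n) atTop (𝓝 c)) :
    Asymptotics.IsEquivalent atTop u (fun n => c * b n) := by
  refine Asymptotics.isEquivalent_of_tendsto_one ?_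
  have := h.div_const c
  rw [div_self hc] at this
  refine this.congr fun n => ?_
  rw [Pi.div_apply, div_div, mul_comm]

omit [IsProbabilityMeasure P] in
/-- Replacing the holding times by almost surely equal ones does not change the record count. -/
lemma recordCount_ae_eq {T' : ℕ → ℕ → Ω → ℝ} (h : ∀ i v, T i v =ᵐ[P] T' i v) :
    ∀ᵐ ω ∂P, ∀ k n r, recordCount T k n r ω = recordCount T' k n r ω := by
  have hall : ∀ᵐ ω ∂P, ∀ i v, T i v ω = T' i v ω :=
    ae_all_iff.2 fun i => ae_all_iff.2 fun v => h i v
  filter_upwards [hall] with ω hω k n r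
  have hring : ∀ r v, ringTime T r v ω = ringTime T' r v ω := fun r v =>
    Finset.sum_congr rfl fun i _ => hω i v
  refine Finset.sum_congr rfl fun v _ => ?_
  have hmem : ω ∈ recordEvent T k r v ↔ ω ∈ recordEvent T' k r v := by
    simp [recordEvent, hring]
  by_cases hv : ω ∈ recordEvent T k r v
  · rw [indicator_of_mem hv, indicator_of_mem (hmem.1 hv)]
  · rw [indicator_of_notMem hv, indicator_of_notMem (mt hmem.2 hv)]

lemma gam_two_sub_eta_two_sq : gam 2 - eta 2 1 ^ 2 = Real.pi ^ 2 / 2 + 2 - 2 * Real.pi := by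
  have h1 : ((2 : ℝ) ^ (1 / 2 : ℝ)) ^ 2 = 2 := by
    rw [← Real.sqrt_eq_rpow, Real.sq_sqrt two_pos.le]
  have h2 : Real.sqrt Real.pi ^ 2 = Real.pi := Real.sq_sqrt Real.pi_pos.le
  have hg : gam 2 = 2 + Real.pi ^ 2 / 2 := by
    simp [gam, lam]
    norm_num
    ring
  have he : eta 2 1 ^ 2 = 2 * Real.pi := by
    have : eta 2 1 = (2 : ℝ) ^ (1 / 2 : ℝ) * Real.sqrt Real.pi := by
      rw [← Real.Gamma_one_half_eq]
      simp [eta]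
      norm_num
    rw [this, mul_pow, h1, h2]
  rw [hg, he]
  ring

end Asymptotics

end KCut

theorem mainTheorem3 {Ω : Type*} [MeasurableSpace Ω] (P : Measure Ω) [IsProbabilityMeasure P]
    (T : ℕ → ℕ → Ω → ℝ)
    (hlaw : ∀ i v, HasLaw (T i v) (expMeasure 1) P)
    (hindep : iIndepFun (fun p : ℕ × ℕ => T p.1 p.2) P)
    (k : ℕ) (hk : 2 ≤ k) :
    Asymptotics.IsEquivalent Filter.atTop
      (fun n : ℕ => ∫ ω, KCut.recordCount T k n 1 ω * (KCut.recordCount T k n 1 ω - 1) ∂P)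
      (fun n : ℕ => ∫ ω, KCut.recordCount T k n 1 ω ^ 2 ∂P) ∧
    Asymptotics.IsEquivalent Filter.atTop
      (fun n : ℕ => ∫ ω, KCut.recordCount T k n 1 ω ^ 2 ∂P)
      (fun n : ℕ => KCut.gam k * (n : ℝ) ^ (2 - 2 / (k : ℝ))) ∧
    Asymptotics.IsEquivalent Filter.atTop
      (fun n : ℕ => variance (KCut.recordCount T k n 1) P)
      (fun n : ℕ => (KCut.gam k - KCut.eta k 1 ^ 2) * (n : ℝ) ^ (2 - 2 / (k : ℝ))) ∧
    (k = 2 →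
      Asymptotics.IsEquivalent Filter.atTop
        (fun n : ℕ => variance (KCut.recordCount T k n 1) P)
        (fun n : ℕ => (Real.pi ^ 2 / 2 + 2 - 2 * Real.pi) * (n : ℝ))) := by
  -- `HasLaw` gives only almost everywhere measurability; genuinely measurable versions leave the
  -- moments and the variance unchanged.
  set T' : ℕ → ℕ → Ω → ℝ := fun i v => (hlaw i v).aemeasurable.mk (T i v) with hT'
  have hae : ∀ i v, T i v =ᵐ[P] T' i v := fun i v => (hlaw i v).aemeasurable.ae_eq_mk
  have hm : ∀ i v, Measurable (T' i v) := fun i v => (hlaw i v).aemeasurable.measurable_mk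
  have hl : ∀ i v, P.map (T' i v) = expMeasure 1 := fun i v => by
    rw [← Measure.map_congr (hae i v), (hlaw i v).map_eq]
  have hi : iIndepFun (fun p : ℕ × ℕ => T' p.1 p.2) P := hindep.congr fun p => hae p.1 p.2
  have hcount := KCut.recordCount_ae_eq hae
  have e1 : ∀ n, ∫ ω, KCut.recordCount T k n 1 ω * (KCut.recordCount T k n 1 ω - 1) ∂P =
      ∫ ω, KCut.recordCount T' k n 1 ω * (KCut.recordCount T' k n 1 ω - 1) ∂P := fun n =>
    integral_congr_ae (hcount.mono fun ω hω => by simp only [hω])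
  have e2 : ∀ n, ∫ ω, KCut.recordCount T k n 1 ω ^ 2 ∂P =
      ∫ ω, KCut.recordCount T' k n 1 ω ^ 2 ∂P := fun n =>
    integral_congr_ae (hcount.mono fun ω hω => by simp only [hω])
  have e3 : ∀ n, variance (KCut.recordCount T k n 1) P =
      variance (KCut.recordCount T' k n 1) P := fun n =>
    variance_congr (hcount.mono fun ω hω => hω k n 1)
  simp only [e1, e2, e3]
  have hgam := (KCut.gam_pos hk).ne'
  have a1 := KCut.isEquivalent_const_mul_of_tendsto_div hgam
    (KCut.tendsto_integral_recordCount_mul_sub_one hm hl hi hk)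
  have a2 := KCut.isEquivalent_const_mul_of_tendsto_div hgam
    (KCut.tendsto_integral_recordCount_sq hm hl hi hk)
  have a3 := KCut.isEquivalent_const_mul_of_tendsto_div
    (sub_pos.2 (KCut.eta_sq_lt_gam hk)).ne' (KCut.tendsto_variance_recordCount hm hl hi hk)
  refine ⟨a1.trans a2.symm, a2, a3, ?_⟩
  rintro rfl
  convert a3 using 2 with n
  rw [KCut.gam_two_sub_eta_two_sq]
  norm_num
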